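/- Let $(\widetilde M,P,\pi)$ be a deformation of manifolds: $P$ is a $C^\infty$ manifold of real dimension $s$, $\widetilde M$ is a $C^\infty$ manifold of real dimension $2n+s$, and $\pi:\widetilde M\to P$ is a surjective $C^\infty$ map such that $\widetilde M$ is covered by open sets $U_\alpha$ with $C^\infty$ coordinates $(z^\alpha,t^\alpha):U_\alpha\cong D_\alpha\times V_\alpha$ ($D_\alpha\subset\mathbb C^n$, $V_\alpha\subset\mathbb R^s$ open), where $\pi(U_\alpha)$ is diffeomorphic to $V_\alpha$, $\pi$ corresponds to the projection $D_\alpha\times V_\alpha\to V_\alpha$, and the coordinate changes $z^\alpha\mapsto z^\beta(z^\alpha,t^\alpha)$ are holomorphic for each fixed $t^\alpha$. Thus the fibers $M_t=\pi^{-1}(t)$ are complex manifolds. Let $\widetilde{\mathcal O}$ be the sheaf of complex valued $C^\infty$ functions on $\widetilde M$ that are holomorphic on the fibers, let $T\pi$ be the bundle of holomorphic tangent spaces of the fibers, and let $\widetilde{\mathcal O}(T\pi)$ be the sheaf of its sections that are locally of the form $\sum_i f_i\,\partial/\partial z^\alpha_i$ with $f_i\in\widetilde{\mathcal O}$. Let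 $\widetilde{\mathcal F}\subset\widetilde{\mathcal O}(T\pi)$ be a deformation of foliations, i.e. an $\widetilde{\mathcal O}$-submodule with $[\widetilde{\mathcal F},\widetilde{\mathcal F}]\subset\widetilde{\mathcal F}$ that is coherent in the sense that locally on $\widetilde M$ there is an exact sequence $\widetilde{\mathcal O}^p\to\widetilde{\mathcal O}^q\to\widetilde{\mathcal F}\to0$. Put $\mathcal N_{\widetilde{\mathcal F}}=\widetilde{\mathcal O}(T\pi)/\widetilde{\mathcal F}$ and $$S(\widetilde{\mathcal F})=\{x\in\widetilde M:\ \mathcal N_{\widetilde{\mathcal F},x}\text{ is not a free }\widetilde{\mathcal O}_x\text{-module}\}.$$ For $t\in P$ let $\mathcal R=\pi^*C^\infty_P\subset\widetilde{\mathcal O}$ be the sheaf of pullbacks of complex valued smooth functions on $P$, let $\mathcal I_t\subset C^\infty_P$ be the ideal sheaf of functions vanishing at $t$, let $\mathcal F_t=\widetilde{\mathcal F}\otimes_{\mathcal R}\mathcal R/\pi^*\mathcal I_t$, and let $\mathcal N_{\mathcal F_t}$ be the cokernel of the natural map $\mathcal F_t\to\mathcal O_{M_t}(TM_t)$, i.e.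 the quotient of $\mathcal O_{M_t}(TM_t)$ by the $\mathcal O_{M_t}$-submodule generated by the restrictions to $M_t$ of the local sections of $\widetilde{\mathcal F}$. Define $S(\mathcal F_t)=M_t$ if $M_t\subset S(\widetilde{\mathcal F})$, and otherwise $$S(\mathcal F_t)=\{x\in M_t:\ \mathcal N_{\mathcal F_t,x}\text{ is not a free }\mathcal O_{M_t,x}\text{-module}\}.$$ Then for every $t\in P$ such that the fiber $M_t$ is connected, $$S(\mathcal F_t)=S(\widetilde{\mathcal F})\cap M_t .$$ -/

import Mathlib

open scoped Manifold ContDiff Topology TensorProduct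
open Filter

noncomputable section

/-- The model space `ℂⁿ × ℝˢ`, a real vector space of dimension `2n + s`. -/
abbrev DefModel (n s : ℕ) : Type := (Fin n → ℂ) × (Fin s → ℝ)

/-- A deformation of manifolds `(M, P, π)` with `n`-dimensional complex fibres and `s`-dimensional
parameter space, together with its adapted deformation coordinates covering (indexed by `ι`), which
carries the complex structures of the fibres: `chart a = (zᵃ, tᵃ)` is defined on `U_a`, and
`baseChart a` is the corresponding diffeomorphism `π(U_a) ≅ V`. -/
structure ManifoldDeformation (n s : ℕ) (ι M P : Type*)
    [TopologicalSpace M] [ChartedSpace (DefModel n s) M]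
    [TopologicalSpace P] [ChartedSpace (Fin s → ℝ) P] where
  /-- the projection `π` -/
  proj : M → P
  surjective_proj : Function.Surjective proj
  contMDiff_proj : ContMDiff 𝓘(ℝ, DefModel n s) 𝓘(ℝ, Fin s → ℝ) ∞ proj
  chart : ι → OpenPartialHomeomorph M (DefModel n s)
  baseChart : ι → OpenPartialHomeomorph P (Fin s → ℝ)
  /-- the `U_a` cover `M` -/
  cover : ∀ x : M, ∃ a, x ∈ (chart a).source
  /-- the coordinates are diffeomorphisms onto their images -/
  chart_mem : ∀ a, chart a ∈ IsManifold.maximalAtlas 𝓘(ℝ, DefModel n s) ∞ M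
  baseChart_mem : ∀ a, baseChart a ∈ IsManifold.maximalAtlas 𝓘(ℝ, Fin s → ℝ) ∞ P
  /-- the image of `U_a` is a product `D × V` of open sets, where `V` is the image of `π(U_a)` -/
  target_eq : ∀ a, ∃ D : Set (Fin n → ℂ), IsOpen D ∧ (chart a).target = D ×ˢ (baseChart a).target
  image_source : ∀ a, proj '' (chart a).source = (baseChart a).source
  /-- `π` corresponds to the projection `D × V → V` -/
  baseChart_proj : ∀ a, ∀ x ∈ (chart a).source, baseChart a (proj x) = (chart a x).2
  /-- for fixed `tᵃ`, the coordinate change `zᵃ ↦ zᵇ(zᵃ, tᵃ)` is holomorphic -/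
  holomorphic_change : ∀ a b, ∀ t : Fin s → ℝ,
    DifferentiableOn ℂ (fun z => (chart b ((chart a).symm (z, t))).1)
      {z | (z, t) ∈ (chart a).target ∧ (chart a).symm (z, t) ∈ (chart b).source}

namespace ManifoldDeformation

variable {n s : ℕ} {ι M P : Type*}
  [TopologicalSpace M] [ChartedSpace (DefModel n s) M]
  [TopologicalSpace P] [ChartedSpace (Fin s → ℝ) P]
  (𝒟 : ManifoldDeformation n s ι M P)

/-- The fibre `M_t = π⁻¹(t)`. -/
def fiber (t : P) : Set M := 𝒟.proj ⁻¹' {t}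

/-- The function `z ↦ f(z, tᵃ(x))`: the restriction of `f` to the fibre through `x`, in the
coordinate `zᵃ`. -/
def slice {β : Type*} (a : ι) (x : M) (f : M → β) (z : Fin n → ℂ) : β :=
  f ((𝒟.chart a).symm (z, (𝒟.chart a x).2))

/-- The restriction of `f` to the fibre through `x` is complex differentiable at `x`. -/
def FiberDifferentiableAt (f : M → ℂ) (x : M) : Prop :=
  ∀ a, x ∈ (𝒟.chart a).source → DifferentiableAt ℂ (𝒟.slice a x f) (𝒟.chart a x).1

/-- For `U` open: `f` is a section over `U` of the sheaf `Õ` of `C^∞` functions on `M` that are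
holomorphic on the fibres. -/
def IsRelHol (U : Set M) (f : M → ℂ) : Prop :=
  ContMDiffOn 𝓘(ℝ, DefModel n s) 𝓘(ℝ, ℂ) ∞ f U ∧ ∀ x ∈ U, 𝒟.FiberDifferentiableAt f x

/-- For `U` open: the restriction of `f` to the open subset `U ∩ M_t` of the fibre `M_t` is
holomorphic. -/
def IsFiberHol (t : P) (U : Set M) (f : M → ℂ) : Prop :=
  ∀ x ∈ U ∩ 𝒟.fiber t, 𝒟.FiberDifferentiableAt f x

/-- The holomorphic tangent space `T_x π = T_x(π⁻¹(π(x)))` of the fibre through `x`. A tangent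
vector is given by its components `v a = (v a 1, …, v a n)` with respect to the frames `∂/∂zᵃ_i` of
all the adapted coordinates around `x`, which are related by the complex Jacobian matrices of the
coordinate changes. For the coordinates that are not defined at `x` the entry is `0`. -/
def vertTangent (x : M) : Submodule ℂ (ι → Fin n → ℂ) where
  carrier := {v | (∀ a, x ∉ (𝒟.chart a).source → v a = 0) ∧
    ∀ a b, x ∈ (𝒟.chart a).source → x ∈ (𝒟.chart b).source →
      v b = fderiv ℂ (𝒟.slice a x fun y => (𝒟.chart b y).1) (𝒟.chart a x).1 (v a)}
  add_mem' := by
    rintro v w ⟨hv, hv'⟩ ⟨hw, hw'⟩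
    refine ⟨fun a ha => by simp [hv a ha, hw a ha], fun a b ha hb => ?_⟩
    rw [Pi.add_apply, Pi.add_apply, map_add, ← hv' a b ha hb, ← hw' a b ha hb]
  zero_mem' := ⟨fun _ _ => rfl, fun a b _ _ => by simp⟩
  smul_mem' := by
    rintro c v ⟨hv, hv'⟩
    refine ⟨fun a ha => by simp [hv a ha], fun a b ha hb => ?_⟩
    rw [Pi.smul_apply, Pi.smul_apply, map_smul, ← hv' a b ha hb]

/-- For `U` open: `X` is a section over `U` of `Õ(Tπ)`, i.e. on each `U_a` it is
`∑ f_i ∂/∂zᵃ_i` with `f_i ∈ Õ(U ∩ U_a)`. -/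
def IsRelHolField (U : Set M) (X : M → ι → Fin n → ℂ) : Prop :=
  (∀ x ∈ U, X x ∈ 𝒟.vertTangent x) ∧
    ∀ a i, 𝒟.IsRelHol (U ∩ (𝒟.chart a).source) fun x => X x a i

/-- For `U` open: `X` is a holomorphic vector field on the open subset `U ∩ M_t` of the complex
manifold `M_t`. -/
def IsFiberHolField (t : P) (U : Set M) (X : M → ι → Fin n → ℂ) : Prop :=
  (∀ x ∈ U ∩ 𝒟.fiber t, X x ∈ 𝒟.vertTangent x) ∧
    ∀ a i, 𝒟.IsFiberHol t (U ∩ (𝒟.chart a).source) fun x => X x a i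

open Classical in
/-- The Lie bracket of sections of `Tπ`, computed in each adapted coordinate system:
`[X, Y]_i = ∑_j (X_j ∂Y_i/∂z_j - Y_j ∂X_i/∂z_j)`. -/
def bracket (X Y : M → ι → Fin n → ℂ) (x : M) (a : ι) : Fin n → ℂ :=
  if x ∈ (𝒟.chart a).source then
    VectorField.lieBracket ℂ (𝒟.slice a x fun y => X y a) (𝒟.slice a x fun y => Y y a)
      (𝒟.chart a x).1
  else 0

variable {𝒟} in
theorem IsRelHol.mono {U V : Set M} {f : M → ℂ} (h : 𝒟.IsRelHol U f) (hVU : V ⊆ U) :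
    𝒟.IsRelHol V f :=
  ⟨h.1.mono hVU, fun x hx => h.2 x (hVU hx)⟩

variable {𝒟} in
theorem IsRelHol.add {U : Set M} {f g : M → ℂ} (hf : 𝒟.IsRelHol U f) (hg : 𝒟.IsRelHol U g) :
    𝒟.IsRelHol U (f + g) :=
  ⟨hf.1.add hg.1, fun x hx a ha => (hf.2 x hx a ha).add (hg.2 x hx a ha)⟩

variable {𝒟} in
theorem IsRelHol.mul {U : Set M} {f g : M → ℂ} (hf : 𝒟.IsRelHol U f) (hg : 𝒟.IsRelHol U g) :
    𝒟.IsRelHol U (f * g) :=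
  ⟨contDiff_mul.contMDiff.comp_contMDiffOn (hf.1.prodMk_space hg.1), fun x hx a ha => (hf.2 x hx a ha).mul (hg.2 x hx a ha)⟩

theorem isRelHol_const (U : Set M) (c : ℂ) : 𝒟.IsRelHol U fun _ => c :=
  ⟨contMDiffOn_const, fun _ _ _ _ => differentiableAt_const c⟩

/-- The stalk `Õ_x`. -/
def stalk (x : M) : Subring (Germ (𝓝 x) ℂ) where
  carrier := {g | ∃ (U : Set M) (f : M → ℂ), IsOpen U ∧ x ∈ U ∧ 𝒟.IsRelHol U f ∧ g = ↑f}
  zero_mem' := ⟨Set.univ, _, isOpen_univ, trivial, 𝒟.isRelHol_const _ 0, rfl⟩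
  one_mem' := ⟨Set.univ, _, isOpen_univ, trivial, 𝒟.isRelHol_const _ 1, rfl⟩
  add_mem' := by
    rintro _ _ ⟨U, f, hU, hx, hf, rfl⟩ ⟨V, g, hV, hx', hg, rfl⟩
    exact ⟨U ∩ V, f + g, hU.inter hV, ⟨hx, hx'⟩,
      (hf.mono Set.inter_subset_left).add (hg.mono Set.inter_subset_right), rfl⟩
  mul_mem' := by
    rintro _ _ ⟨U, f, hU, hx, hf, rfl⟩ ⟨V, g, hV, hx', hg, rfl⟩
    exact ⟨U ∩ V, f * g, hU.inter hV, ⟨hx, hx'⟩,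
      (hf.mono Set.inter_subset_left).mul (hg.mono Set.inter_subset_right), rfl⟩
  neg_mem' := by
    rintro _ ⟨U, f, hU, hx, hf, rfl⟩
    exact ⟨U, -f, hU, hx, ⟨hf.1.neg, fun y hy a ha => (hf.2 y hy a ha).neg⟩, rfl⟩

/-- The stalk `Õ(Tπ)_x`, a module over `Õ_x`. -/
def fieldStalk (x : M) : Submodule (𝒟.stalk x) (Germ (𝓝 x) (ι → Fin n → ℂ)) where
  carrier := {g | ∃ (U : Set M) (X : M → ι → Fin n → ℂ),
    IsOpen U ∧ x ∈ U ∧ 𝒟.IsRelHolField U X ∧ g = ↑X}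
  zero_mem' := ⟨Set.univ, 0, isOpen_univ, trivial,
    ⟨fun _ _ => Submodule.zero_mem _, fun _ _ => 𝒟.isRelHol_const _ 0⟩, rfl⟩
  add_mem' := by
    rintro _ _ ⟨U, X, hU, hx, hX, rfl⟩ ⟨V, Y, hV, hx', hY, rfl⟩
    exact ⟨U ∩ V, X + Y, hU.inter hV, ⟨hx, hx'⟩,
      ⟨fun y hy => Submodule.add_mem _ (hX.1 y hy.1) (hY.1 y hy.2), fun a i =>
        ((hX.2 a i).mono fun y hy => ⟨hy.1.1, hy.2⟩).add
          ((hY.2 a i).mono fun y hy => ⟨hy.1.2, hy.2⟩)⟩, rfl⟩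
  smul_mem' := by
    rintro ⟨_, U, f, hU, hx, hf, rfl⟩ _ ⟨V, Y, hV, hx', hY, rfl⟩
    exact ⟨U ∩ V, f • Y, hU.inter hV, ⟨hx, hx'⟩,
      ⟨fun y hy => Submodule.smul_mem _ _ (hY.1 y hy.2), fun a i =>
        (hf.mono fun y hy => hy.1.1).mul
          ((hY.2 a i).mono fun y hy => ⟨hy.1.2, hy.2⟩)⟩, rfl⟩

instance (x : M) : Module (𝒟.stalk x) (𝒟.fieldStalk x) := Submodule.module _

instance (x : M) : SMul (𝒟.stalk x) (𝒟.fieldStalk x) := Module.toDistribMulAction.toSMul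

/-- Germs at `x` of functions on the fibre through `x`. -/
abbrev FiberGerm (x : M) (β : Type*) : Type _ := Germ (𝓝[𝒟.fiber (𝒟.proj x)] x) β

/-- The stalk at `x` of the sheaf `O_{M_t}` of holomorphic functions on `M_t`, `t = π(x)`. -/
def fiberStalk (x : M) : Subring (𝒟.FiberGerm x ℂ) where
  carrier := {g | ∃ (U : Set M) (f : M → ℂ),
    IsOpen U ∧ x ∈ U ∧ 𝒟.IsFiberHol (𝒟.proj x) U f ∧ g = ↑f}
  zero_mem' := ⟨Set.univ, _, isOpen_univ, trivial,
    fun _ _ _ _ => differentiableAt_const (0 : ℂ), rfl⟩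
  one_mem' := ⟨Set.univ, _, isOpen_univ, trivial,
    fun _ _ _ _ => differentiableAt_const (1 : ℂ), rfl⟩
  add_mem' := by
    rintro _ _ ⟨U, f, hU, hx, hf, rfl⟩ ⟨V, g, hV, hx', hg, rfl⟩
    exact ⟨U ∩ V, f + g, hU.inter hV, ⟨hx, hx'⟩, fun y hy a ha =>
      (hf y ⟨hy.1.1, hy.2⟩ a ha).add (hg y ⟨hy.1.2, hy.2⟩ a ha), rfl⟩
  mul_mem' := by
    rintro _ _ ⟨U, f, hU, hx, hf, rfl⟩ ⟨V, g, hV, hx', hg, rfl⟩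
    exact ⟨U ∩ V, f * g, hU.inter hV, ⟨hx, hx'⟩, fun y hy a ha =>
      (hf y ⟨hy.1.1, hy.2⟩ a ha).mul (hg y ⟨hy.1.2, hy.2⟩ a ha), rfl⟩
  neg_mem' := by
    rintro _ ⟨U, f, hU, hx, hf, rfl⟩
    exact ⟨U, -f, hU, hx, fun y hy a ha => (hf y hy a ha).neg, rfl⟩

/-- The stalk `O_{M_t}(TM_t)_x`, `t = π(x)`, a module over `O_{M_t,x}`. -/
def fiberFieldStalk (x : M) :
    Submodule (𝒟.fiberStalk x) (𝒟.FiberGerm x (ι → Fin n → ℂ)) where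
  carrier := {g | ∃ (U : Set M) (X : M → ι → Fin n → ℂ),
    IsOpen U ∧ x ∈ U ∧ 𝒟.IsFiberHolField (𝒟.proj x) U X ∧ g = ↑X}
  zero_mem' := ⟨Set.univ, 0, isOpen_univ, trivial,
    ⟨fun _ _ => Submodule.zero_mem _, fun _ _ _ _ _ _ => differentiableAt_const (0 : ℂ)⟩, rfl⟩
  add_mem' := by
    rintro _ _ ⟨U, X, hU, hx, hX, rfl⟩ ⟨V, Y, hV, hx', hY, rfl⟩
    exact ⟨U ∩ V, X + Y, hU.inter hV, ⟨hx, hx'⟩,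
      ⟨fun y hy => Submodule.add_mem _ (hX.1 y ⟨hy.1.1, hy.2⟩) (hY.1 y ⟨hy.1.2, hy.2⟩),
        fun a i y hy b hb => (hX.2 a i y ⟨⟨hy.1.1.1, hy.1.2⟩, hy.2⟩ b hb).add
          (hY.2 a i y ⟨⟨hy.1.1.2, hy.1.2⟩, hy.2⟩ b hb)⟩, rfl⟩
  smul_mem' := by
    rintro ⟨_, U, f, hU, hx, hf, rfl⟩ _ ⟨V, Y, hV, hx', hY, rfl⟩
    exact ⟨U ∩ V, f • Y, hU.inter hV, ⟨hx, hx'⟩,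
      ⟨fun y hy => Submodule.smul_mem _ _ (hY.1 y ⟨hy.1.2, hy.2⟩),
        fun a i y hy b hb => (hf y ⟨hy.1.1.1, hy.2⟩ b hb).mul
          (hY.2 a i y ⟨⟨hy.1.1.2, hy.1.2⟩, hy.2⟩ b hb)⟩, rfl⟩

instance (x : M) : Module (𝒟.fiberStalk x) (𝒟.fiberFieldStalk x) := Submodule.module _

instance (x : M) : SMul (𝒟.fiberStalk x) (𝒟.fiberFieldStalk x) :=
  Module.toDistribMulAction.toSMul

/-- The stalk at `x` of `R = π^* C^∞_P`: the germs of the functions `h ∘ π`, where `h` is a smooth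
complex valued function near `π(x)`. -/
def baseStalk (x : M) : Subring (𝒟.stalk x) where
  carrier := {g | ∃ (V : Set P) (h : P → ℂ), IsOpen V ∧ 𝒟.proj x ∈ V ∧
    ContMDiffOn 𝓘(ℝ, Fin s → ℝ) 𝓘(ℝ, ℂ) ∞ h V ∧
    (g : Germ (𝓝 x) ℂ) = ((h ∘ 𝒟.proj : M → ℂ) : Germ (𝓝 x) ℂ)}
  zero_mem' := ⟨Set.univ, fun _ => 0, isOpen_univ, trivial, contMDiffOn_const, rfl⟩
  one_mem' := ⟨Set.univ, fun _ => 1, isOpen_univ, trivial, contMDiffOn_const, rfl⟩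
  add_mem' := by
    rintro f g ⟨U, h, hU, hx, hh, e⟩ ⟨V, k, hV, hx', hk, e'⟩
    refine ⟨U ∩ V, h + k, hU.inter hV, ⟨hx, hx'⟩,
      (hh.mono Set.inter_subset_left).add (hk.mono Set.inter_subset_right), ?_⟩
    rw [Subring.coe_add, e, e']; rfl
  mul_mem' := by
    rintro f g ⟨U, h, hU, hx, hh, e⟩ ⟨V, k, hV, hx', hk, e'⟩
    refine ⟨U ∩ V, h * k, hU.inter hV, ⟨hx, hx'⟩, contDiff_mul.contMDiff.comp_contMDiffOn
      ((hh.mono Set.inter_subset_left).prodMk_space (hk.mono Set.inter_subset_right)), ?_⟩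
    rw [Subring.coe_mul, e, e']; rfl
  neg_mem' := by
    rintro f ⟨U, h, hU, hx, hh, e⟩
    refine ⟨U, -h, hU, hx, hh.neg, ?_⟩
    rw [Subring.coe_neg, e]; rfl

instance (x : M) : Module (𝒟.baseStalk x) (𝒟.fieldStalk x) :=
  Module.compHom _ (𝒟.baseStalk x).subtype

instance (x : M) : SMul (𝒟.baseStalk x) (𝒟.fieldStalk x) := Module.toDistribMulAction.toSMul

/-- The value at `x` of the elements of `R_x`. -/
def baseEval (x : M) : 𝒟.baseStalk x →+* ℂ :=
  (Germ.valueRingHom.comp (𝒟.stalk x).subtype).comp (𝒟.baseStalk x).subtype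

/-- The stalk at `x` of `π^* I_t`, `t = π(x)`: the germs `h ∘ π` with `h(t) = 0`. -/
def baseIdeal (x : M) : Ideal (𝒟.baseStalk x) := RingHom.ker (𝒟.baseEval x)

/-- The value at `x` on `(R / π^* I_t)_x`, `t = π(x)`. -/
def quotEval (x : M) : (𝒟.baseStalk x ⧸ 𝒟.baseIdeal x) →+* ℂ :=
  Ideal.Quotient.lift (𝒟.baseIdeal x) (𝒟.baseEval x) fun _ h => h

/-- The restriction of a germ at `x` to the fibre through `x`. -/
def restrictGerm {x : M} {β : Type*} (g : Germ (𝓝 x) β) : 𝒟.FiberGerm x β :=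
  g.compTendsto id (tendsto_id.mono_left nhdsWithin_le_nhds)

/-- The restriction map `Õ(Tπ)_x → O_{M_t}(TM_t)_x`, `t = π(x)`. -/
def restrictField (x : M) : 𝒟.fieldStalk x →+ 𝒟.fiberFieldStalk x where
  toFun X := ⟨𝒟.restrictGerm X.1, by
    obtain ⟨_, U, X, hU, hx, hX, rfl⟩ := X
    exact ⟨U, X, hU, hx, ⟨fun y hy => hX.1 y hy.1, fun a i y hy => (hX.2 a i).2 y hy.1⟩, rfl⟩⟩
  map_zero' := rfl
  map_add' := by
    rintro ⟨_, U, X, hU, hx, hX, rfl⟩ ⟨_, V, Y, hV, hx', hY, rfl⟩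
    rfl

/-- Complex numbers as germs of constant functions on the fibre. -/
def fiberConst (x : M) : ℂ →+* 𝒟.fiberStalk x where
  toFun c := ⟨((fun _ => c : M → ℂ) : 𝒟.FiberGerm x ℂ), Set.univ, _, isOpen_univ, trivial,
    fun _ _ _ _ => differentiableAt_const c, rfl⟩
  map_zero' := rfl
  map_one' := rfl
  map_add' _ _ := rfl
  map_mul' _ _ := rfl

theorem restrictField_smul (x : M) (r : 𝒟.baseStalk x) (X : 𝒟.fieldStalk x) :
    𝒟.restrictField x (r • X) = 𝒟.fiberConst x (𝒟.baseEval x r) • 𝒟.restrictField x X := by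
  obtain ⟨V, h, hV, hx, hh, e⟩ := r.2
  obtain ⟨⟨g, hg⟩, hr⟩ := r
  obtain ⟨_, U, X, hU, hx', hX, rfl⟩ := X
  change g = _ at e
  subst e
  apply Subtype.ext
  refine Germ.coe_eq.2 ?_
  filter_upwards [self_mem_nhdsWithin] with y hy
  have hy' : 𝒟.proj y = 𝒟.proj x := hy
  change (h (𝒟.proj y)) • X y = (h (𝒟.proj x)) • X y
  rw [hy']

/-- A deformation of foliations: a coherent `Õ`-submodule of `Õ(Tπ)` closed under the bracket. The
subsheaf is given by its stalks `F_x ⊆ Õ(Tπ)_x`, which form an open subset of the étalé space; its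
sections over an open set `U` are the `X` whose germ at each `x ∈ U` lies in `F_x`. -/
structure Foliation where
  stalk : ∀ x, Submodule (𝒟.stalk x) (𝒟.fieldStalk x)
  /-- every germ in `F_x` is the germ of a section over a neighbourhood of `x` -/
  exists_section : ∀ x, ∀ g ∈ stalk x, ∃ (U : Set M) (X : M → ι → Fin n → ℂ),
    IsOpen U ∧ x ∈ U ∧ (g : Germ (𝓝 x) (ι → Fin n → ℂ)) = ↑X ∧
      ∀ y ∈ U, ∃ g' ∈ stalk y, (g' : Germ (𝓝 y) (ι → Fin n → ℂ)) = ↑X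
  /-- coherence: locally there is an exact sequence `Õ^p → Õ^q → F → 0`, the first map being given
  by a matrix `A` of sections of `Õ`, the second one by sections `e` of `F` -/
  coherent : ∀ x, ∃ (U : Set M) (p q : ℕ) (A : Fin p → Fin q → M → ℂ)
    (e : Fin q → M → ι → Fin n → ℂ),
    IsOpen U ∧ x ∈ U ∧ (∀ k j, 𝒟.IsRelHol U (A k j)) ∧
    ∀ y ∈ U,
      (stalk y).map (𝒟.fieldStalk y).subtype =
        Submodule.span (𝒟.stalk y)
          (Set.range fun j => (e j : Germ (𝓝 y) (ι → Fin n → ℂ))) ∧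
      ∀ c : Fin q → 𝒟.stalk y,
        ∑ j, c j • (e j : Germ (𝓝 y) (ι → Fin n → ℂ)) = 0 ↔
          ∃ b : Fin p → 𝒟.stalk y, ∀ j,
            (c j : Germ (𝓝 y) ℂ) = ∑ k, (b k : Germ (𝓝 y) ℂ) * (A k j : Germ (𝓝 y) ℂ)
  /-- `[F, F] ⊆ F` -/
  involutive : ∀ (U : Set M) (X Y : M → ι → Fin n → ℂ), IsOpen U →
    (∀ y ∈ U, ∃ g ∈ stalk y, (g : Germ (𝓝 y) (ι → Fin n → ℂ)) = ↑X) →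
    (∀ y ∈ U, ∃ g ∈ stalk y, (g : Germ (𝓝 y) (ι → Fin n → ℂ)) = ↑Y) →
    ∀ y ∈ U, ∃ g ∈ stalk y, (g : Germ (𝓝 y) (ι → Fin n → ℂ)) = ↑(𝒟.bracket X Y)

namespace Foliation

variable {𝒟}
variable (F : 𝒟.Foliation)

/-- The singular set `S(F)`: the points `x` where the stalk of the normal sheaf
`N_F = Õ(Tπ) / F` is not a free `Õ_x`-module. -/
def singularSet : Set M :=
  {x | ¬ Module.Free (𝒟.stalk x) (𝒟.fieldStalk x ⧸ F.stalk x)}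

instance (x : M) : Module (𝒟.stalk x) (F.stalk x) := Submodule.module _

/-- `F_x` as a module over the subring `R_x` of `Õ_x`. -/
instance (x : M) : Module (𝒟.baseStalk x) (F.stalk x) :=
  Module.compHom _ (𝒟.baseStalk x).subtype

instance (x : M) : SMul (𝒟.baseStalk x) (F.stalk x) := Module.toDistribMulAction.toSMul

/-- The stalk at `x` of `F_t = F ⊗_R R / π^* I_t`, `t = π(x)`. -/
abbrev RestrictedStalk (x : M) : Type _ :=
  F.stalk x ⊗[𝒟.baseStalk x] (𝒟.baseStalk x ⧸ 𝒟.baseIdeal x)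

/-- The map `(X, [r]) ↦ r(x) · X|_{M_t}`, `t = π(x)`. -/
def restrictPairing (x : M) :
    F.stalk x →+ (𝒟.baseStalk x ⧸ 𝒟.baseIdeal x) →+ 𝒟.fiberFieldStalk x :=
  AddMonoidHom.mk'
    (fun X => AddMonoidHom.mk'
      (fun r => 𝒟.fiberConst x (𝒟.quotEval x r) • 𝒟.restrictField x X.1)
      (fun r r' => by rw [map_add, map_add, add_smul]))
    (fun X Y => by
      apply AddMonoidHom.ext
      intro r
      change 𝒟.fiberConst x _ • 𝒟.restrictField x (X.1 + Y.1) =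
        𝒟.fiberConst x _ • 𝒟.restrictField x X.1 + 𝒟.fiberConst x _ • 𝒟.restrictField x Y.1
      rw [map_add, smul_add])

theorem restrictPairing_mk (x : M) (X : F.stalk x) (r : 𝒟.baseStalk x) :
    F.restrictPairing x X (Ideal.Quotient.mk (𝒟.baseIdeal x) r) =
      𝒟.fiberConst x (𝒟.baseEval x r) • 𝒟.restrictField x X.1 := rfl

theorem restrictPairing_smul (x : M) (r : 𝒟.baseStalk x) (X : F.stalk x)
    (q : 𝒟.baseStalk x ⧸ 𝒟.baseIdeal x) :
    F.restrictPairing x (r • X) q = F.restrictPairing x X (r • q) := by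
  obtain ⟨q, rfl⟩ := Ideal.Quotient.mk_surjective q
  have h : r • Ideal.Quotient.mk (𝒟.baseIdeal x) q =
    Ideal.Quotient.mk (𝒟.baseIdeal x) (r * q) := rfl
  have h' : ((r • X : F.stalk x) : 𝒟.fieldStalk x) = r • (X : 𝒟.fieldStalk x) := rfl
  rw [h, restrictPairing_mk, restrictPairing_mk, h', 𝒟.restrictField_smul, smul_smul, ← map_mul,
    ← map_mul, mul_comm]

/-- The natural map `F_t → O_{M_t}(TM_t)` on stalks at `x`, `t = π(x)`: it sends `X ⊗ [r]` to
`r(x)` times the restriction of `X` to `M_t`. -/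
def toFiberField (x : M) : F.RestrictedStalk x →+ 𝒟.fiberFieldStalk x :=
  TensorProduct.liftAddHom (F.restrictPairing x) (F.restrictPairing_smul x)

/-- The image of `F_t → O_{M_t}(TM_t)` on stalks at `x`, as an `O_{M_t,x}`-submodule: the stalk of
the restricted foliation on `M_t`, generated by the restrictions to `M_t` of the sections of `F`. -/
def fiberStalk (x : M) : Submodule (𝒟.fiberStalk x) (𝒟.fiberFieldStalk x) :=
  Submodule.span _ (Set.range (F.toFiberField x))

open Classical in
/-- The singular set `S(F_t)` of the restricted foliation: it is `M_t` by convention if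
`M_t ⊆ S(F)`, and otherwise the set of points `x` of `M_t` where the stalk of the normal sheaf
`N_{F_t} = O_{M_t}(TM_t) / F_t` is not a free `O_{M_t,x}`-module. -/
def fiberSingularSet (t : P) : Set M :=
  if 𝒟.fiber t ⊆ F.singularSet then 𝒟.fiber t
  else {x ∈ 𝒟.fiber t |
    ¬ Module.Free (𝒟.fiberStalk x) (𝒟.fiberFieldStalk x ⧸ F.fiberStalk x)}

end Foliation

end ManifoldDeformation

end

/-! Everything is controlled by the rank `r(x)` of the foliation (`rankAt`), the dimension of the
span of the values at `x` of its sections. In an adapted chart, with local generators of the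
foliation, `r` is the pointwise rank of a matrix `B` of functions smooth on the total space and
holomorphic along the fibres.

The normal stalk is the cokernel of `B`, and it is free exactly when the column space of `B` has a
free complement, a condition consisting of matrix identities. Such identities restrict to the fibre,
so freeness on the total space implies freeness on the fibre (`free_fiber_of_free`). Reading them
pointwise gives two rank criteria: the normal stalk at `x` is free iff `r` has a local maximum at
`x` (`free_iff_isLocalMax`), and if the normal stalk on the fibre is free, then `r` restricted to
the fibre has a local maximum there (`isLocalMaxOn_of_free_fiber`).

For the converse of restriction, bounds on `r` are moved along the connected fibre. The minors of
`B` are holomorphic on fibres, so by the identity theorem a bound `r ≤ k` near one point of the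
fibre spreads over the fibre; applied to the nearby fibres too, it spreads a bound valid on a
neighbourhood in the total space. If the fibre is not contained in the singular set, it has a point
`y` where `r` is locally maximal. If the fibre stalk at `x` is free, then `r(y) ≤ r(x)`; the bound
`r ≤ r(y)` moves from near `y` to near `x`, so `r ≤ r(x)` near `x` and the stalk at `x` is free. -/

noncomputable section

/-! ### Free complements of column spaces, and rank of matrices of germs -/

namespace Matrix

/-- The column space of `B` has a free complement, expressed by matrix identities: the columns of
`V` form a basis of the complement and `D` is the projection to it along the column space. -/
def HasFreeComplement {R : Type*} [CommRing R] {n q : ℕ} (B : Matrix (Fin n) (Fin q) R) : Prop :=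
  ∃ (m : ℕ) (V : Matrix (Fin n) (Fin m) R) (A : Matrix (Fin q) (Fin n) R)
    (D : Matrix (Fin m) (Fin n) R), D * V = 1 ∧ D * B = 0 ∧ B * A + V * D = 1

/-- Used for the restriction of germs to a fibre, and for the inclusion of a stalk in the ring of
all germs, where identities can be read pointwise. -/
theorem HasFreeComplement.map {R R' : Type*} [CommRing R] [CommRing R'] {n q : ℕ}
    {B : Matrix (Fin n) (Fin q) R} (h : B.HasFreeComplement) (f : R →+* R') :
    (B.map f).HasFreeComplement := by
  obtain ⟨m, V, A, D, h1, h2, h3⟩ := h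
  refine ⟨m, V.map f, A.map f, D.map f, ?_, ?_, ?_⟩
  · rw [← Matrix.map_mul, h1, Matrix.map_one f (map_zero f) (map_one f)]
  · rw [← Matrix.map_mul, h2, Matrix.map_zero f (map_zero f)]
  · rw [← Matrix.map_mul, ← Matrix.map_mul, ← Matrix.map_add f (map_add f), h3,
      Matrix.map_one f (map_zero f) (map_one f)]

theorem free_quotient_range_iff {R : Type*} [CommRing R] {n q : ℕ}
    (B : Matrix (Fin n) (Fin q) R) :
    Module.Free R ((Fin n → R) ⧸ LinearMap.range B.mulVecLin) ↔ B.HasFreeComplement := by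
  constructor
  · intro hfree
    set Q := (Fin n → R) ⧸ LinearMap.range B.mulVecLin
    let b := (Module.Free.chooseBasis R Q).reindex (Fintype.equivFin _)
    set m := Fintype.card (Module.Free.ChooseBasisIndex R Q)
    let δ : (Fin n → R) →ₗ[R] (Fin m → R) :=
      b.equivFun.toLinearMap ∘ₗ (LinearMap.range B.mulVecLin).mkQ
    have hδs : Function.Surjective δ :=
      b.equivFun.surjective.comp (Submodule.mkQ_surjective _)
    have hδ0 : ∀ v, δ v = 0 ↔ ∃ w, B *ᵥ w = v := by
      intro v
      simp [δ, Q, Submodule.Quotient.mk_eq_zero]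
    choose v hv using fun l : Fin m => hδs (Pi.single l 1)
    let V : Matrix (Fin n) (Fin m) R := Matrix.of fun i l => v l i
    let D : Matrix (Fin m) (Fin n) R := LinearMap.toMatrix' δ
    have hD : ∀ w, D *ᵥ w = δ w := fun w => by
      rw [← Matrix.toLin'_apply, Matrix.toLin'_toMatrix']
    have hVcol : ∀ l, V *ᵥ Pi.single l 1 = v l := fun l => by
      ext i; simp [V]
    have hDV : D * V = 1 := by
      apply Matrix.toLin'.injective
      refine LinearMap.pi_ext' fun l => LinearMap.ext_ring ?_
      simp only [LinearMap.comp_apply, LinearMap.single_apply, Matrix.toLin'_apply]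
      rw [← Matrix.mulVec_mulVec, hVcol, hD, hv, Matrix.one_mulVec]
    have hDB : D * B = 0 := by
      apply Matrix.toLin'.injective
      refine LinearMap.ext fun w => ?_
      simp only [Matrix.toLin'_apply]
      rw [← Matrix.mulVec_mulVec, hD, (hδ0 _).2 ⟨w, rfl⟩, Matrix.zero_mulVec]
    -- `1 - V * D` maps into the kernel of `δ`, which is the column space of `B`, so it factors
    -- through `B`; the factor is `A`.
    have hker : ∀ i, ∃ w, B *ᵥ w = ((1 - V * D) *ᵥ Pi.single i 1) := by
      intro i
      rw [← hδ0, ← hD, Matrix.mulVec_mulVec, Matrix.mul_sub, ← Matrix.mul_assoc, hDV,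
        Matrix.mul_one, Matrix.one_mul, sub_self, Matrix.zero_mulVec]
    choose a ha using hker
    refine ⟨m, V, Matrix.of fun j i => a i j, D, hDV, hDB, ?_⟩
    rw [← eq_sub_iff_add_eq]
    apply Matrix.toLin'.injective
    refine LinearMap.pi_ext' fun i => LinearMap.ext_ring ?_
    simp only [LinearMap.comp_apply, LinearMap.single_apply, Matrix.toLin'_apply]
    rw [← ha, ← Matrix.mulVec_mulVec]
    congr 1
    ext j
    simp
  · rintro ⟨m, V, A, D, h1, h2, h3⟩
    let φ : ((Fin n → R) ⧸ LinearMap.range B.mulVecLin) →ₗ[R] (Fin m → R) :=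
      Submodule.liftQ _ D.mulVecLin (by
        rintro _ ⟨w, rfl⟩
        simp [Matrix.mulVec_mulVec, h2])
    let ψ : (Fin m → R) →ₗ[R] ((Fin n → R) ⧸ LinearMap.range B.mulVecLin) :=
      Submodule.mkQ _ ∘ₗ V.mulVecLin
    refine Module.Free.of_equiv (LinearEquiv.ofLinearMap ψ φ ?_ ?_)
    · apply Submodule.linearMap_qext
      refine LinearMap.ext fun w => ?_
      change Submodule.Quotient.mk (V *ᵥ (D *ᵥ w)) = Submodule.Quotient.mk w
      rw [Submodule.Quotient.eq]
      refine ⟨-(A *ᵥ w), ?_⟩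
      have : V * D = 1 - B * A := eq_sub_of_add_eq' h3
      rw [Matrix.mulVec_mulVec, this, Matrix.sub_mulVec, Matrix.one_mulVec,
        ← Matrix.mulVec_mulVec]
      simp [Matrix.mulVec_neg]
    · refine LinearMap.ext fun w => ?_
      change D *ᵥ (V *ᵥ w) = w
      rw [Matrix.mulVec_mulVec, h1, Matrix.one_mulVec]

/-- The identity makes the two column spaces span `Kⁿ`; the rank bound then forces, by counting
dimensions, a direct sum and an injective `V`. Hence the projections determined by `A` and `D` are
the expected ones. -/
theorem complement_of_rank_le {K : Type*} [Field K] {n q m : ℕ} {B : Matrix (Fin n) (Fin q) K}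
    {V : Matrix (Fin n) (Fin m) K} {A : Matrix (Fin q) (Fin n) K} {D : Matrix (Fin m) (Fin n) K}
    (h : B * A + V * D = 1) (hr : B.rank + m ≤ n) : D * V = 1 ∧ D * B = 0 := by
  have hsum : ∀ w, B *ᵥ (A *ᵥ w) + V *ᵥ (D *ᵥ w) = w := fun w => by
    rw [Matrix.mulVec_mulVec, Matrix.mulVec_mulVec, ← Matrix.add_mulVec, h, Matrix.one_mulVec]
  have htop : LinearMap.range B.mulVecLin ⊔ LinearMap.range V.mulVecLin = ⊤ := by
    refine eq_top_iff.2 fun w _ => ?_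
    rw [← hsum w]
    exact Submodule.add_mem_sup ⟨_, rfl⟩ ⟨_, rfl⟩
  have hd := Submodule.finrank_sup_add_finrank_inf_eq (LinearMap.range B.mulVecLin)
    (LinearMap.range V.mulVecLin)
  rw [htop, finrank_top, Module.finrank_fin_fun] at hd
  have hB : B.rank = Module.finrank K (LinearMap.range B.mulVecLin) := rfl
  have hV := LinearMap.finrank_range_add_finrank_ker V.mulVecLin
  rw [Module.finrank_fin_fun] at hV
  have hinf : LinearMap.range B.mulVecLin ⊓ LinearMap.range V.mulVecLin = ⊥ :=
    Submodule.finrank_eq_zero.1 (by omega)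
  have hker : LinearMap.ker V.mulVecLin = ⊥ := Submodule.finrank_eq_zero.1 (by omega)
  have key : ∀ u w, B *ᵥ u = V *ᵥ w → w = 0 := by
    intro u w huw
    have hmem : V *ᵥ w ∈ LinearMap.range B.mulVecLin ⊓ LinearMap.range V.mulVecLin :=
      ⟨⟨u, huw⟩, ⟨w, rfl⟩⟩
    rw [hinf, Submodule.mem_bot] at hmem
    have : w ∈ LinearMap.ker V.mulVecLin := hmem
    rwa [hker] at this
  constructor
  · apply Matrix.toLin'.injective
    refine LinearMap.ext fun w => ?_
    simp only [Matrix.toLin'_apply, Matrix.one_mulVec]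
    rw [← Matrix.mulVec_mulVec, ← sub_eq_zero, ← neg_eq_zero, neg_sub]
    refine key (A *ᵥ (V *ᵥ w)) _ ?_
    rw [Matrix.mulVec_sub]
    exact eq_sub_of_add_eq (hsum (V *ᵥ w))
  · apply Matrix.toLin'.injective
    refine LinearMap.ext fun w => ?_
    simp only [Matrix.toLin'_apply, Matrix.zero_mulVec]
    rw [← Matrix.mulVec_mulVec]
    refine key (w - A *ᵥ (B *ᵥ w)) _ ?_
    rw [Matrix.mulVec_sub]
    exact sub_eq_of_eq_add' (hsum (B *ᵥ w)).symm

theorem rank_add_le_rank_add_rank {K : Type*} [Field K] {n q : ℕ}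
    (M N : Matrix (Fin n) (Fin q) K) : (M + N).rank ≤ M.rank + N.rank := by
  refine (Submodule.finrank_mono ?_).trans
    (Submodule.finrank_add_le_finrank_add_finrank (LinearMap.range M.mulVecLin)
      (LinearMap.range N.mulVecLin))
  rintro _ ⟨w, rfl⟩
  rw [Matrix.mulVecLin_apply, Matrix.add_mulVec]
  exact Submodule.add_mem_sup ⟨w, rfl⟩ ⟨w, rfl⟩

theorem exists_complement {K : Type*} [Field K] {n q : ℕ} (B : Matrix (Fin n) (Fin q) K) :
    ∃ (m : ℕ) (V : Matrix (Fin n) (Fin m) K) (A : Matrix (Fin q) (Fin n) K)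
      (D : Matrix (Fin m) (Fin n) K), B.rank + m = n ∧ B * A + V * D = 1 := by
  obtain ⟨m, V, A, D, h1, h2, h3⟩ := (free_quotient_range_iff B).1 inferInstance
  refine ⟨m, V, A, D, le_antisymm ?_ ?_, h3⟩
  · have hm : m ≤ D.rank := by
      have := rank_mul_le_left D V
      rwa [h1, rank_one, Fintype.card_fin] at this
    have := rank_add_rank_le_card_of_mul_eq_zero h2
    rw [Fintype.card_fin] at this
    omega
  · have h : (1 : Matrix (Fin n) (Fin n) K).rank ≤ (B * A).rank + (V * D).rank := by
      rw [← h3]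
      exact rank_add_le_rank_add_rank _ _
    rw [rank_one, Fintype.card_fin] at h
    have := rank_mul_le_left B A
    have := rank_mul_le_left V D
    have := rank_le_width V
    omega

theorem map_coeRingHom_eq_iff {α K : Type*} [Semiring K] {l : Filter α} {a b : Type*} [Finite a]
    [Finite b] {M N : Matrix a b (α → K)} :
    M.map (Germ.coeRingHom l) = N.map (Germ.coeRingHom l) ↔
      ∀ᶠ y in l, M.map (Pi.evalRingHom _ y) = N.map (Pi.evalRingHom _ y) := by
  simp only [← Matrix.ext_iff, eventually_all]
  exact forall_congr' fun i => forall_congr' fun j => Germ.coe_eq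

theorem exists_map_coeRingHom_eq {α K : Type*} [Semiring K] {l : Filter α} {a b : Type*}
    (M : Matrix a b (Germ l K)) :
    ∃ N : Matrix a b (α → K), N.map (Germ.coeRingHom l) = M := by
  choose N hN using fun i j => Quotient.exists_rep (M i j)
  exact ⟨Matrix.of N, Matrix.ext hN⟩

theorem map_coeRingHom_one {α K : Type*} [Semiring K] {l : Filter α} {a : Type*} [DecidableEq a] :
    (1 : Matrix a a (α → K)).map (Germ.coeRingHom l) = 1 :=
  Matrix.map_one _ (map_zero _) (map_one _)

/-- At nearby points `D` has rank at least `m` and kills `B`, so `B` has rank at most `n - m`. At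
`x`, `B * A + V * D = 1` forces rank at least `n - m`; `pure x ≤ l` allows evaluation of this
identity at `x`. -/
theorem HasFreeComplement.rank_le {α K : Type*} [Field K] {l : Filter α} {x : α} (hx : pure x ≤ l)
    {n q : ℕ} {B : Matrix (Fin n) (Fin q) (α → K)}
    (h : (B.map (Germ.coeRingHom l)).HasFreeComplement) :
    ∀ᶠ y in l, (B.map (Pi.evalRingHom _ y)).rank ≤ (B.map (Pi.evalRingHom _ x)).rank := by
  obtain ⟨m, V, A, D, h1, h2, h3⟩ := h
  obtain ⟨V, rfl⟩ := exists_map_coeRingHom_eq V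
  obtain ⟨A, rfl⟩ := exists_map_coeRingHom_eq A
  obtain ⟨D, rfl⟩ := exists_map_coeRingHom_eq D
  have h0 : (0 : Matrix (Fin m) (Fin q) (α → K)).map (Germ.coeRingHom l) = 0 :=
    Matrix.map_zero _ (map_zero _)
  rw [← Matrix.map_mul, ← map_coeRingHom_one, map_coeRingHom_eq_iff] at h1
  rw [← Matrix.map_mul, ← h0, map_coeRingHom_eq_iff] at h2
  rw [← Matrix.map_mul, ← Matrix.map_mul, ← Matrix.map_add _ (map_add _), ← map_coeRingHom_one,
    map_coeRingHom_eq_iff] at h3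
  have h3x := hx h3
  have hxn : n ≤ (B.map (Pi.evalRingHom _ x)).rank + m := by
    change (B * A + V * D).map (Pi.evalRingHom (fun _ => K) x) =
      (1 : Matrix _ _ (α → K)).map (Pi.evalRingHom (fun _ => K) x) at h3x
    rw [Matrix.map_one _ (map_zero _) (map_one _), Matrix.map_add _ (map_add _), Matrix.map_mul,
      Matrix.map_mul] at h3x
    have h := rank_add_le_rank_add_rank (B.map (Pi.evalRingHom (fun _ => K) x) * A.map (Pi.evalRingHom _ x))
      (V.map (Pi.evalRingHom (fun _ => K) x) * D.map (Pi.evalRingHom _ x))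
    rw [h3x, rank_one, Fintype.card_fin] at h
    have := rank_mul_le_left (B.map (Pi.evalRingHom (fun _ => K) x)) (A.map (Pi.evalRingHom _ x))
    have := rank_mul_le_left (V.map (Pi.evalRingHom (fun _ => K) x)) (D.map (Pi.evalRingHom _ x))
    have := rank_le_width (V.map (Pi.evalRingHom (fun _ => K) x))
    omega
  filter_upwards [h1, h2] with y h1 h2
  rw [Matrix.map_one _ (map_zero _) (map_one _), Matrix.map_mul] at h1
  rw [Matrix.map_zero _ (map_zero _), Matrix.map_mul] at h2
  have hm := rank_mul_le_left (D.map (Pi.evalRingHom (fun _ => K) y)) (V.map (Pi.evalRingHom _ y))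
  rw [h1, rank_one, Fintype.card_fin] at hm
  have := rank_add_rank_le_card_of_mul_eq_zero h2
  rw [Fintype.card_fin] at this
  omega

/-- A complement at the single point `x`, extended by constant matrices, remains one nearby: the
identity `B * A + V * D = 1` is restored by inverting a matrix equal to `1` at `x`, and the rank
bound gives the other two identities pointwise. -/
theorem hasFreeComplement_of_rank_le {α K : Type*} [Field K] {l : Filter α} {x : α}
    {S : Subring (Germ l K)}
    (hconst : ∀ c : K, Germ.coeRingHom l (fun _ => c) ∈ S)
    (hunit : ∀ (s : S) (f : α → K), (s : Germ l K) = Germ.coeRingHom l f → f x ≠ 0 → IsUnit s)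
    {n q : ℕ} {B : Matrix (Fin n) (Fin q) S} {B' : Matrix (Fin n) (Fin q) (α → K)}
    (hB : B.map S.subtype = B'.map (Germ.coeRingHom l))
    (hr : ∀ᶠ y in l, (B'.map (Pi.evalRingHom _ y)).rank ≤ (B'.map (Pi.evalRingHom _ x)).rank) :
    B.HasFreeComplement := by
  obtain ⟨m, V0, A0, D0, hm, h0⟩ := exists_complement (B'.map (Pi.evalRingHom _ x))
  let cst : K →+* S := ((Germ.coeRingHom l).comp (Pi.constRingHom α K)).codRestrict S hconst
  have hcst {a b : ℕ} (W : Matrix (Fin a) (Fin b) K) :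
      (W.map cst).map S.subtype = (W.map (Pi.constRingHom α K)).map (Germ.coeRingHom l) := rfl
  have hev {a b : ℕ} (W : Matrix (Fin a) (Fin b) K) (y : α) :
      (W.map (Pi.constRingHom α K)).map (Pi.evalRingHom _ y) = W := rfl
  set U : Matrix (Fin n) (Fin n) S := B * A0.map cst + V0.map cst * D0.map cst with hU
  set U' : Matrix (Fin n) (Fin n) (α → K) := B' * A0.map (Pi.constRingHom α K) +
    V0.map (Pi.constRingHom α K) * D0.map (Pi.constRingHom α K) with hU'
  have hUU' : U.map S.subtype = U'.map (Germ.coeRingHom l) := by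
    rw [hU, hU', Matrix.map_add _ (map_add _), Matrix.map_add _ (map_add _), Matrix.map_mul,
      Matrix.map_mul, Matrix.map_mul, Matrix.map_mul, hB, hcst, hcst, hcst]
  -- `U` takes the value `1` at `x`, so its determinant is a germ with nonzero value.
  have hdet : IsUnit U.det := by
    refine hunit _ U'.det ?_ ?_
    · rw [RingHom.map_det]
      change S.subtype U.det = _
      rw [RingHom.map_det]
      exact congrArg det hUU'
    · change Pi.evalRingHom (fun _ => K) x U'.det ≠ 0
      rw [RingHom.map_det]
      have : (Pi.evalRingHom (fun _ => K) x).mapMatrix U' = 1 := by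
        rw [RingHom.mapMatrix_apply, hU', Matrix.map_add _ (map_add _), Matrix.map_mul,
          Matrix.map_mul, hev, hev, hev, h0]
      rw [this, det_one]
      exact one_ne_zero
  have hone : B * (A0.map cst * U⁻¹) + V0.map cst * (D0.map cst * U⁻¹) = 1 := by
    rw [← Matrix.mul_assoc, ← Matrix.mul_assoc, ← Matrix.add_mul, ← hU, mul_nonsing_inv _ hdet]
  generalize A0.map cst * U⁻¹ = A at hone
  generalize D0.map cst * U⁻¹ = D at hone
  obtain ⟨A', hA'⟩ := exists_map_coeRingHom_eq (A.map S.subtype)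
  obtain ⟨D', hD'⟩ := exists_map_coeRingHom_eq (D.map S.subtype)
  have hone' := congrArg (fun M : Matrix (Fin n) (Fin n) S => M.map S.subtype) hone
  simp only [Matrix.map_one S.subtype (map_zero _) (map_one _)] at hone'
  rw [Matrix.map_add _ (map_add _), Matrix.map_mul, Matrix.map_mul, hB, hcst, ← hA', ← hD',
    ← Matrix.map_mul, ← Matrix.map_mul, ← Matrix.map_add _ (map_add _), ← map_coeRingHom_one,
    map_coeRingHom_eq_iff] at hone'
  have hinj {a b : ℕ} {M N : Matrix (Fin a) (Fin b) S} (h : M.map S.subtype = N.map S.subtype) :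
      M = N := Matrix.map_injective S.subtype_injective h
  -- The rank at `y` is at most that at `x`, which is `n - m`; this is the hypothesis of
  -- `complement_of_rank_le`.
  have hcomp : ∀ᶠ y in l,
      D'.map (Pi.evalRingHom (fun _ => K) y) * V0 = 1 ∧
      D'.map (Pi.evalRingHom (fun _ => K) y) * B'.map (Pi.evalRingHom (fun _ => K) y) = 0 := by
    filter_upwards [hone', hr] with y h1 h2
    rw [Matrix.map_one _ (map_zero _) (map_one _), Matrix.map_add _ (map_add _), Matrix.map_mul,
      Matrix.map_mul, hev] at h1
    exact complement_of_rank_le h1 (by omega)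
  refine ⟨m, V0.map cst, A, D, hinj ?_, hinj ?_, hone⟩
  · rw [Matrix.map_mul, ← hD', hcst, ← Matrix.map_mul, Matrix.map_one _ (map_zero _) (map_one _),
      ← map_coeRingHom_one, map_coeRingHom_eq_iff]
    filter_upwards [hcomp] with y hy
    rw [Matrix.map_mul, hev, hy.1, Matrix.map_one _ (map_zero _) (map_one _)]
  · have h0 : (0 : Matrix (Fin m) (Fin q) (α → K)).map (Germ.coeRingHom l) = 0 :=
      Matrix.map_zero _ (map_zero _)
    rw [Matrix.map_mul, ← hD', hB, ← Matrix.map_mul, Matrix.map_zero _ (map_zero _), ← h0,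
      map_coeRingHom_eq_iff]
    filter_upwards [hcomp] with y hy
    rw [Matrix.map_mul, hy.2, Matrix.map_zero _ (map_zero _)]

end Matrix

/-! ### Adapted coordinates and frames of the relative tangent bundle -/

/-- A directional derivative of a holomorphic map of class `C²` is holomorphic. -/
theorem differentiableAt_fderiv_apply_of_contDiffAt {E F : Type*} [NormedAddCommGroup E]
    [NormedSpace ℂ E] [NormedAddCommGroup F] [NormedSpace ℂ F] {g : E → F} {z : E}
    (hg : ∀ᶠ w in 𝓝 z, DifferentiableAt ℂ g w) (hg2 : ContDiffAt ℝ 2 g z) (v : E) :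
    DifferentiableAt ℂ (fun w => fderiv ℂ g w v) z := by
  have hreal : ∀ᶠ w in 𝓝 z, fderiv ℝ g w = (fderiv ℂ g w).restrictScalars ℝ :=
    hg.mono fun w hw => hw.fderiv_restrictScalars ℝ
  have hd : HasFDerivAt (fderiv ℝ g) (fderiv ℝ (fderiv ℝ g) z) z :=
    ((hg2.fderiv_right (m := 1) (by norm_num)).differentiableAt (by norm_num)).hasFDerivAt
  have happ : ∀ u, HasFDerivAt (fun w => fderiv ℝ g w u)
      ((fderiv ℝ (fderiv ℝ g) z).flip u) z := fun u => by
    have := hd.clm_apply (hasFDerivAt_const u z)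
    simpa using this
  have hsymm : IsSymmSndFDerivAt ℝ g z := hg2.isSymmSndFDerivAt (by simp)
  -- By symmetry of the second derivative, `c • u` can be moved to the slot of the first derivative,
  -- which is complex linear near `z`.
  have hlin : ∀ (c : ℂ) (u : E), (fderiv ℝ (fderiv ℝ g) z).flip v (c • u) =
      c • (fderiv ℝ (fderiv ℝ g) z).flip v u := by
    intro c u
    have h1 : HasFDerivAt (fun w => fderiv ℝ g w (c • u))
        (c • (fderiv ℝ (fderiv ℝ g) z).flip u) z := by
      refine ((happ u).const_smul c).congr_of_eventuallyEq ?_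
      filter_upwards [hreal] with w hw
      rw [Pi.smul_apply, hw]
      exact map_smul (fderiv ℂ g w) c u
    have h2 := DFunLike.congr_fun ((happ (c • u)).unique h1) v
    rw [ContinuousLinearMap.flip_apply, ContinuousLinearMap.flip_apply, hsymm.eq _ v,
      hsymm.eq u v]
    simpa using h2
  let L : E →L[ℂ] F :=
    { toFun := (fderiv ℝ (fderiv ℝ g) z).flip v
      map_add' := map_add _
      map_smul' := hlin
      cont := ((fderiv ℝ (fderiv ℝ g) z).flip v).continuous }
  have hL : HasFDerivAt (fun w => fderiv ℝ g w v) L z :=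
    hasFDerivAt_of_restrictScalars ℝ (happ v) rfl
  refine (hL.congr_of_eventuallyEq ?_).differentiableAt
  filter_upwards [hreal] with w hw
  rw [hw]
  rfl

namespace ManifoldDeformation

variable {n s : ℕ} {ι M P : Type*}
  [TopologicalSpace M] [ChartedSpace (DefModel n s) M]
  [TopologicalSpace P] [ChartedSpace (Fin s → ℝ) P]
  {𝒟 : ManifoldDeformation n s ι M P} {a b c : ι} {x y : M}

/-- On `U_a` the coordinate `tᵃ` is `π` followed by an injective chart of the base, so the fibres
are the slices of constant `tᵃ`. -/
theorem snd_chart_eq_iff (hx : x ∈ (𝒟.chart a).source) (hy : y ∈ (𝒟.chart a).source) :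
    (𝒟.chart a x).2 = (𝒟.chart a y).2 ↔ 𝒟.proj x = 𝒟.proj y := by
  have hmem : ∀ {w}, w ∈ (𝒟.chart a).source → 𝒟.proj w ∈ (𝒟.baseChart a).source := fun hw =>
    𝒟.image_source a ▸ Set.mem_image_of_mem _ hw
  rw [← 𝒟.baseChart_proj a x hx, ← 𝒟.baseChart_proj a y hy]
  exact (𝒟.baseChart a).injOn.eq_iff (hmem hx) (hmem hy)

theorem slice_congr {β : Type*} (hx : x ∈ (𝒟.chart a).source) (hy : y ∈ (𝒟.chart a).source)
    (h : 𝒟.proj x = 𝒟.proj y) (f : M → β) : 𝒟.slice a x f = 𝒟.slice a y f := by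
  unfold slice
  rw [(snd_chart_eq_iff hx hy).2 h]

/-- The point of the fibre through `x` with the coordinate `z`. -/
def slicePoint (𝒟 : ManifoldDeformation n s ι M P) (a : ι) (x : M) (z : Fin n → ℂ) : M :=
  𝒟.slice a x id z

theorem slice_eq_slicePoint {β : Type*} (f : M → β) (z : Fin n → ℂ) :
    𝒟.slice a x f z = f (𝒟.slicePoint a x z) := rfl

theorem slicePoint_self (hx : x ∈ (𝒟.chart a).source) :
    𝒟.slicePoint a x (𝒟.chart a x).1 = x := (𝒟.chart a).left_inv hx

theorem chart_slicePoint {z : Fin n → ℂ} (hz : (z, (𝒟.chart a x).2) ∈ (𝒟.chart a).target) :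
    𝒟.chart a (𝒟.slicePoint a x z) = (z, (𝒟.chart a x).2) := (𝒟.chart a).right_inv hz

theorem slicePoint_mem_source {z : Fin n → ℂ}
    (hz : (z, (𝒟.chart a x).2) ∈ (𝒟.chart a).target) :
    𝒟.slicePoint a x z ∈ (𝒟.chart a).source := (𝒟.chart a).map_target hz

theorem proj_slicePoint {z : Fin n → ℂ} (hx : x ∈ (𝒟.chart a).source)
    (hz : (z, (𝒟.chart a x).2) ∈ (𝒟.chart a).target) :
    𝒟.proj (𝒟.slicePoint a x z) = 𝒟.proj x := by
  rw [← snd_chart_eq_iff (slicePoint_mem_source hz) hx, chart_slicePoint hz]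

theorem slicePoint_fst_chart (hx : x ∈ (𝒟.chart a).source) (hy : y ∈ (𝒟.chart a).source)
    (h : 𝒟.proj y = 𝒟.proj x) : 𝒟.slicePoint a x (𝒟.chart a y).1 = y := by
  unfold slicePoint
  rw [← slice_congr hy hx h]
  exact slicePoint_self hy

theorem eventually_slice_mem_target (hx : x ∈ (𝒟.chart a).source) :
    ∀ᶠ z in 𝓝 (𝒟.chart a x).1, (z, (𝒟.chart a x).2) ∈ (𝒟.chart a).target := by
  have h : ContinuousAt (fun z : Fin n → ℂ => (z, (𝒟.chart a x).2)) (𝒟.chart a x).1 := by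
    fun_prop
  exact h.eventually ((𝒟.chart a).open_target.mem_nhds ((𝒟.chart a).map_source hx))

theorem tendsto_slicePoint (hx : x ∈ (𝒟.chart a).source) :
    Tendsto (𝒟.slicePoint a x) (𝓝 (𝒟.chart a x).1) (𝓝 x) := by
  have h : ContinuousAt (fun z : Fin n → ℂ => (z, (𝒟.chart a x).2)) (𝒟.chart a x).1 := by
    fun_prop
  have h2 := (𝒟.chart a).tendsto_symm hx
  exact h2.comp h.tendsto

theorem slice_transition {β : Type*} (ha : x ∈ (𝒟.chart a).source)
    (hb : x ∈ (𝒟.chart b).source) (f : M → β) :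
    𝒟.slice a x f =ᶠ[𝓝 (𝒟.chart a x).1]
      𝒟.slice b x f ∘ 𝒟.slice a x fun y => (𝒟.chart b y).1 := by
  filter_upwards [eventually_slice_mem_target ha,
    (tendsto_slicePoint ha).eventually ((𝒟.chart b).open_source.mem_nhds hb)] with z hz hz'
  rw [Function.comp_apply, slice_eq_slicePoint, slice_eq_slicePoint, slice_eq_slicePoint,
    slicePoint_fst_chart hb hz' (proj_slicePoint ha hz)]

theorem transition_self (ha : x ∈ (𝒟.chart a).source) (f : M → Fin n → ℂ) :
    𝒟.slice a x f (𝒟.chart a x).1 = f x := by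
  rw [slice_eq_slicePoint, slicePoint_self ha]

theorem differentiableAt_transition (ha : x ∈ (𝒟.chart a).source)
    (hb : x ∈ (𝒟.chart b).source) :
    DifferentiableAt ℂ (𝒟.slice a x fun y => (𝒟.chart b y).1) (𝒟.chart a x).1 := by
  refine (𝒟.holomorphic_change a b (𝒟.chart a x).2).differentiableAt ?_
  filter_upwards [eventually_slice_mem_target ha,
    (tendsto_slicePoint ha).eventually ((𝒟.chart b).open_source.mem_nhds hb)] with z hz hz'
  exact ⟨hz, hz'⟩

/-- Coordinate changes along a fibre are holomorphic, so one chart suffices. -/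
theorem fiberDifferentiableAt_iff (hb : x ∈ (𝒟.chart b).source) {f : M → ℂ} :
    𝒟.FiberDifferentiableAt f x ↔ DifferentiableAt ℂ (𝒟.slice b x f) (𝒟.chart b x).1 := by
  refine ⟨fun h => h b hb, fun h a ha => ?_⟩
  refine DifferentiableAt.congr_of_eventuallyEq ?_ (slice_transition ha hb f)
  refine DifferentiableAt.comp _ ?_ (differentiableAt_transition ha hb)
  rwa [transition_self ha]

theorem fderiv_transition_comp (ha : x ∈ (𝒟.chart a).source) (hb : x ∈ (𝒟.chart b).source)
    (hc : x ∈ (𝒟.chart c).source) (v : Fin n → ℂ) :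
    fderiv ℂ (𝒟.slice a x fun y => (𝒟.chart c y).1) (𝒟.chart a x).1 v =
      fderiv ℂ (𝒟.slice b x fun y => (𝒟.chart c y).1) (𝒟.chart b x).1
        (fderiv ℂ (𝒟.slice a x fun y => (𝒟.chart b y).1) (𝒟.chart a x).1 v) := by
  rw [(slice_transition ha hb fun y => (𝒟.chart c y).1).fderiv_eq, fderiv_comp]
  · rw [transition_self ha]
    rfl
  · rw [transition_self ha]
    exact differentiableAt_transition hb hc
  · exact differentiableAt_transition ha hb

theorem fderiv_transition_self (ha : x ∈ (𝒟.chart a).source) (v : Fin n → ℂ) :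
    fderiv ℂ (𝒟.slice a x fun y => (𝒟.chart a y).1) (𝒟.chart a x).1 v = v := by
  have h : (𝒟.slice a x fun y => (𝒟.chart a y).1) =ᶠ[𝓝 (𝒟.chart a x).1] id := by
    filter_upwards [eventually_slice_mem_target ha] with z hz
    rw [slice_eq_slicePoint, chart_slicePoint hz]
    rfl
  rw [h.fderiv_eq, fderiv_id]
  rfl

/-- The Jacobians determine all components from those in one chart. -/
theorem vertTangent_ext {v w : ι → Fin n → ℂ} (ha : x ∈ (𝒟.chart a).source)
    (hv : v ∈ 𝒟.vertTangent x) (hw : w ∈ 𝒟.vertTangent x) (h : v a = w a) : v = w := by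
  funext b
  by_cases hb : x ∈ (𝒟.chart b).source
  · rw [hv.2 a b ha hb, hw.2 a b ha hb, h]
  · rw [hv.1 b hb, hw.1 b hb]

open Classical in
/-- The vector field `∂/∂zᵃ_i` on `U_a`. -/
def frame (𝒟 : ManifoldDeformation n s ι M P) (a : ι) (i : Fin n) (x : M) (c : ι) : Fin n → ℂ :=
  if x ∈ (𝒟.chart c).source then
    fderiv ℂ (𝒟.slice a x fun y => (𝒟.chart c y).1) (𝒟.chart a x).1 (Pi.single i 1)
  else 0

theorem frame_apply (i : Fin n) (hc : x ∈ (𝒟.chart c).source) :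
    𝒟.frame a i x c =
      fderiv ℂ (𝒟.slice a x fun y => (𝒟.chart c y).1) (𝒟.chart a x).1 (Pi.single i 1) :=
  if_pos hc

theorem frame_self (ha : x ∈ (𝒟.chart a).source) (i : Fin n) :
    𝒟.frame a i x a = Pi.single i 1 := by
  rw [frame_apply i ha, fderiv_transition_self ha]

theorem frame_mem_vertTangent (ha : x ∈ (𝒟.chart a).source) (i : Fin n) :
    𝒟.frame a i x ∈ 𝒟.vertTangent x := by
  refine ⟨fun b hb => if_neg hb, fun b c hb hc => ?_⟩
  rw [frame_apply i hb, frame_apply i hc, fderiv_transition_comp ha hb hc]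

theorem contDiffOn_chart_comp_symm [IsManifold 𝓘(ℝ, DefModel n s) ∞ M] (a c : ι) :
    ContDiffOn ℝ ∞ (𝒟.chart c ∘ (𝒟.chart a).symm)
      ((𝒟.chart a).target ∩ (𝒟.chart a).symm ⁻¹' (𝒟.chart c).source) := by
  rw [← contMDiffOn_iff_contDiffOn]
  exact (contMDiffOn_of_mem_maximalAtlas (𝒟.chart_mem c)).comp
    ((contMDiffOn_symm_of_mem_maximalAtlas (𝒟.chart_mem a)).mono Set.inter_subset_left)
    Set.inter_subset_right

theorem isOpen_overlap (a c : ι) :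
    IsOpen ((𝒟.chart a).target ∩ (𝒟.chart a).symm ⁻¹' (𝒟.chart c).source) :=
  (𝒟.chart a).isOpen_inter_preimage_symm (𝒟.chart c).open_source

theorem chart_mem_overlap (ha : x ∈ (𝒟.chart a).source) (hc : x ∈ (𝒟.chart c).source) :
    𝒟.chart a x ∈ (𝒟.chart a).target ∩ (𝒟.chart a).symm ⁻¹' (𝒟.chart c).source :=
  ⟨(𝒟.chart a).map_source ha, by rwa [Set.mem_preimage, (𝒟.chart a).left_inv ha]⟩

theorem isRelHolField_frame [IsManifold 𝓘(ℝ, DefModel n s) ∞ M] (a : ι) (i : Fin n) :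
    𝒟.IsRelHolField (𝒟.chart a).source (𝒟.frame a i) := by
  refine ⟨fun x hx => frame_mem_vertTangent hx i, fun c k => ⟨?_, ?_⟩⟩
  · have hG := contDiffOn_chart_comp_symm (𝒟 := 𝒟) a c
    have hO := isOpen_overlap (𝒟 := 𝒟) a c
    have hG' : ContDiffOn ℝ ∞ (fun p : DefModel n s =>
        (fderiv ℝ (𝒟.chart c ∘ (𝒟.chart a).symm) p (Pi.single i 1, 0)).1 k)
        ((𝒟.chart a).target ∩ (𝒟.chart a).symm ⁻¹' (𝒟.chart c).source) := by
      have h1 := (hG.fderiv_of_isOpen (m := ∞) hO (by simp)).clm_apply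
        (contDiffOn_const (c := ((Pi.single i 1, 0) : DefModel n s)))
      exact contDiffOn_pi.1 h1.fst k
    have hcomp := (contMDiffOn_iff_contDiffOn.2 hG').comp
      ((contMDiffOn_of_mem_maximalAtlas (𝒟.chart_mem a)).mono
        (Set.inter_subset_left (t := (𝒟.chart c).source)))
      (fun x hx => chart_mem_overlap hx.1 hx.2)
    refine hcomp.congr fun x hx => ?_
    rw [frame_apply i hx.2, Function.comp_apply]
    have hdiff : DifferentiableAt ℝ (𝒟.chart c ∘ (𝒟.chart a).symm)
        ((𝒟.chart a x).1, (𝒟.chart a x).2) :=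
      (hG.contDiffAt (hO.mem_nhds (chart_mem_overlap hx.1 hx.2))).differentiableAt (by simp)
    have h2 : HasFDerivAt (𝒟.slice a x fun y => (𝒟.chart c y).1)
        ((ContinuousLinearMap.fst ℝ (Fin n → ℂ) (Fin s → ℝ)).comp
          ((fderiv ℝ (𝒟.chart c ∘ (𝒟.chart a).symm) (𝒟.chart a x)).comp
            (ContinuousLinearMap.inl ℝ (Fin n → ℂ) (Fin s → ℝ)))) (𝒟.chart a x).1 := by
      have h1 := hdiff.hasFDerivAt.comp (𝒟.chart a x).1
        (hasFDerivAt_prodMk_left (𝕜 := ℝ) (𝒟.chart a x).1 (𝒟.chart a x).2)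
      exact h1.fst
    -- The complex derivative along the fibre is the real partial derivative in the `z` directions
    -- of the full coordinate change, which is smooth in `(z, t)`.
    have h3 := (differentiableAt_transition hx.1 hx.2).fderiv_restrictScalars ℝ
    rw [h2.fderiv] at h3
    exact congrFun (DFunLike.congr_fun h3 (Pi.single i 1)).symm k
  · intro x hx
    rw [fiberDifferentiableAt_iff hx.1]
    have hev : ∀ᶠ z in 𝓝 (𝒟.chart a x).1, (z, (𝒟.chart a x).2) ∈ (𝒟.chart a).target ∧
        𝒟.slicePoint a x z ∈ (𝒟.chart c).source :=
      (eventually_slice_mem_target hx.1).and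
        ((tendsto_slicePoint hx.1).eventually ((𝒟.chart c).open_source.mem_nhds hx.2))
    have hd : ∀ᶠ z in 𝓝 (𝒟.chart a x).1,
        DifferentiableAt ℂ (𝒟.slice a x fun y => (𝒟.chart c y).1) z := by
      filter_upwards [hev] with z hz
      have := differentiableAt_transition (slicePoint_mem_source hz.1) hz.2
      rwa [slice_congr (slicePoint_mem_source hz.1) hx.1 (proj_slicePoint hx.1 hz.1),
        chart_slicePoint hz.1] at this
    have hsmooth : ContDiffAt ℝ 2 (𝒟.slice a x fun y => (𝒟.chart c y).1) (𝒟.chart a x).1 := by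
      have h1 : ContDiffAt ℝ 2 (𝒟.chart c ∘ (𝒟.chart a).symm)
          ((𝒟.chart a x).1, (𝒟.chart a x).2) :=
        ((contDiffOn_chart_comp_symm a c).contDiffAt ((isOpen_overlap a c).mem_nhds
          (chart_mem_overlap hx.1 hx.2))).of_le ENat.LEInfty.out
      have h2 : ContDiffAt ℝ 2 (fun z : Fin n → ℂ => (z, (𝒟.chart a x).2)) (𝒟.chart a x).1 :=
        contDiffAt_id.prodMk contDiffAt_const
      exact (h1.comp (𝒟.chart a x).1 h2).fst
    -- Along the fibre the frame is a directional derivative of a holomorphic map, hence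
    -- holomorphic.
    have h := differentiableAt_pi.1
      (differentiableAt_fderiv_apply_of_contDiffAt hd hsmooth (Pi.single i 1)) k
    refine h.congr_of_eventuallyEq ?_
    filter_upwards [hev] with z hz
    rw [slice_eq_slicePoint, frame_apply i hz.2,
      slice_congr (slicePoint_mem_source hz.1) hx.1 (proj_slicePoint hx.1 hz.1),
      chart_slicePoint hz.1]

/-- The components of the germs of `Õ(Tπ)` with respect to the frame `∂/∂zᵃ_i`. -/
def fieldComponents (𝒟 : ManifoldDeformation n s ι M P) (ha : x ∈ (𝒟.chart a).source) :
    𝒟.fieldStalk x →ₗ[𝒟.stalk x] Fin n → 𝒟.stalk x where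
  toFun g i := ⟨(g : Germ (𝓝 x) (ι → Fin n → ℂ)).map fun v => v a i, by
    obtain ⟨_, U, X, hU, hx, hX, rfl⟩ := g
    exact ⟨_, _, hU.inter (𝒟.chart a).open_source, ⟨hx, ha⟩, hX.2 a i, rfl⟩⟩
  map_add' := by
    rintro ⟨_, U, X, hU, hx, hX, rfl⟩ ⟨_, V, Y, hV, hx', hY, rfl⟩
    rfl
  map_smul' := by
    rintro ⟨_, U, f, hU, hx, hf, rfl⟩ ⟨_, V, Y, hV, hx', hY, rfl⟩
    rfl

/-- The components of the germs of `O_{M_t}(TM_t)` with respect to the frame `∂/∂zᵃ_i`. -/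
def fiberFieldComponents (𝒟 : ManifoldDeformation n s ι M P) (ha : x ∈ (𝒟.chart a).source) :
    𝒟.fiberFieldStalk x →ₗ[𝒟.fiberStalk x] Fin n → 𝒟.fiberStalk x where
  toFun g i := ⟨(g : 𝒟.FiberGerm x (ι → Fin n → ℂ)).map fun v => v a i, by
    obtain ⟨_, U, X, hU, hx, hX, rfl⟩ := g
    exact ⟨_, _, hU.inter (𝒟.chart a).open_source, ⟨hx, ha⟩, hX.2 a i, rfl⟩⟩
  map_add' := by
    rintro ⟨_, U, X, hU, hx, hX, rfl⟩ ⟨_, V, Y, hV, hx', hY, rfl⟩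
    rfl
  map_smul' := by
    rintro ⟨_, U, f, hU, hx, hf, rfl⟩ ⟨_, V, Y, hV, hx', hY, rfl⟩
    rfl

theorem surjective_of_single {R E : Type*} [CommRing R] [AddCommGroup E] [Module R E]
    (φ : E →ₗ[R] Fin n → R) (h : ∀ i, ∃ d, φ d = Pi.single i 1) : Function.Surjective φ := by
  choose d hd using h
  intro f
  refine ⟨∑ i, f i • d i, ?_⟩
  rw [map_sum]
  simp only [map_smul, hd]
  exact (pi_eq_sum_univ' f).symm

theorem fieldComponents_bijective [IsManifold 𝓘(ℝ, DefModel n s) ∞ M]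
    (ha : x ∈ (𝒟.chart a).source) : Function.Bijective (𝒟.fieldComponents ha) := by
  constructor
  · rw [injective_iff_map_eq_zero]
    rintro ⟨_, U, X, hU, hx, hX, rfl⟩ h
    have h0 : ∀ᶠ y in 𝓝 x, ∀ i, X y a i = 0 := by
      rw [eventually_all]
      exact fun i => Germ.coe_eq.1 (congrArg Subtype.val (congrFun h i))
    refine Subtype.ext (Germ.coe_eq.2 ?_)
    filter_upwards [h0, hU.mem_nhds hx, (𝒟.chart a).open_source.mem_nhds ha] with y hy hyU hya
    exact vertTangent_ext hya (hX.1 y hyU) (Submodule.zero_mem _) (funext hy)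
  · refine surjective_of_single _ fun i => ⟨⟨(𝒟.frame a i : Germ (𝓝 x) _), _, _,
      (𝒟.chart a).open_source, ha, isRelHolField_frame a i, rfl⟩, ?_⟩
    funext j
    refine Subtype.ext ?_
    have h : ((fun y => 𝒟.frame a i y a j : M → ℂ) : Germ (𝓝 x) ℂ) =
        ((fun _ => (Pi.single i 1 : Fin n → ℂ) j : M → ℂ) : Germ (𝓝 x) ℂ) := by
      refine Germ.coe_eq.2 ?_
      filter_upwards [(𝒟.chart a).open_source.mem_nhds ha] with y hy
      rw [frame_self hy]
    refine h.trans ?_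
    by_cases hij : j = i
    · subst hij
      rw [Pi.single_eq_same, Pi.single_eq_same]
      rfl
    · rw [Pi.single_eq_of_ne hij, Pi.single_eq_of_ne hij]
      rfl

theorem fiberFieldComponents_bijective [IsManifold 𝓘(ℝ, DefModel n s) ∞ M]
    (ha : x ∈ (𝒟.chart a).source) : Function.Bijective (𝒟.fiberFieldComponents ha) := by
  constructor
  · rw [injective_iff_map_eq_zero]
    rintro ⟨_, U, X, hU, hx, hX, rfl⟩ h
    have h0 : ∀ᶠ y in 𝓝[𝒟.fiber (𝒟.proj x)] x, ∀ i, X y a i = 0 := by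
      rw [eventually_all]
      exact fun i => Germ.coe_eq.1 (congrArg Subtype.val (congrFun h i))
    refine Subtype.ext (Germ.coe_eq.2 ?_)
    filter_upwards [h0, mem_nhdsWithin_of_mem_nhds (hU.mem_nhds hx), self_mem_nhdsWithin,
      mem_nhdsWithin_of_mem_nhds ((𝒟.chart a).open_source.mem_nhds ha)] with y hy hyU hyt hya
    exact vertTangent_ext hya (hX.1 y ⟨hyU, hyt⟩) (Submodule.zero_mem _) (funext hy)
  -- The frame on the fibre is obtained by restricting the relative frame.
  · refine surjective_of_single _ fun i => ?_
    obtain ⟨d, hd⟩ := (fieldComponents_bijective ha).2 (Pi.single i 1)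
    refine ⟨𝒟.restrictField x d, ?_⟩
    funext j
    obtain ⟨_, U, X, hU, hx, hX, rfl⟩ := d
    have hj := congrArg (𝒟.restrictGerm ∘ Subtype.val) (congrFun hd j)
    refine Subtype.ext (Eq.trans hj ?_)
    by_cases hij : j = i
    · subst hij
      rw [Function.comp_apply, Pi.single_eq_same, Pi.single_eq_same]
      rfl
    · rw [Function.comp_apply, Pi.single_eq_of_ne hij, Pi.single_eq_of_ne hij]
      rfl

end ManifoldDeformation

/-! ### Freeness of the normal stalks in terms of the rank -/

theorem Module.free_quotient_iff_hasFreeComplement {R E : Type*} [CommRing R] [AddCommGroup E]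
    [Module R E] {n q : ℕ} (φ : E →ₗ[R] Fin n → R) (hφ : Function.Bijective φ) (e : Fin q → E) :
    Module.Free R (E ⧸ Submodule.span R (Set.range e)) ↔
      (Matrix.of fun i j => φ (e j) i).HasFreeComplement := by
  have h : (Submodule.span R (Set.range e)).map (LinearEquiv.ofBijective φ hφ : E →ₗ[R] _) =
      LinearMap.range (Matrix.of fun i j => φ (e j) i).mulVecLin := by
    rw [Matrix.range_mulVecLin, Submodule.map_span, ← Set.range_comp]
    rfl
  rw [← Matrix.free_quotient_range_iff]
  let ψ := Submodule.Quotient.equiv _ _ (LinearEquiv.ofBijective φ hφ) h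
  exact ⟨fun _ => Module.Free.of_equiv ψ, fun _ => Module.Free.of_equiv ψ.symm⟩

namespace ManifoldDeformation

variable {n s : ℕ} {ι M P : Type*}
  [TopologicalSpace M] [ChartedSpace (DefModel n s) M]
  [TopologicalSpace P] [ChartedSpace (Fin s → ℝ) P]
  {𝒟 : ManifoldDeformation n s ι M P} {a : ι} {x : M}

/-- A germ of `Õ_x` with nonzero value at `x` is invertible. -/
theorem isUnit_stalk (σ : 𝒟.stalk x) (f : M → ℂ) (hσ : (σ : Germ (𝓝 x) ℂ) = ↑f)
    (hf : f x ≠ 0) : IsUnit σ := by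
  obtain ⟨_, U, g, hU, hx, hg, rfl⟩ := σ
  have hgx : g x ≠ 0 := by
    have h : g =ᶠ[𝓝 x] f := Germ.coe_eq.1 hσ
    rwa [h.self_of_nhds]
  have hV : IsOpen (U ∩ g ⁻¹' {0}ᶜ) :=
    hg.1.continuousOn.isOpen_inter_preimage hU isOpen_compl_singleton
  have hinv : 𝒟.IsRelHol (U ∩ g ⁻¹' {0}ᶜ) fun y => (g y)⁻¹ := by
    refine ⟨fun y hy => ?_, fun y hy b hb => ?_⟩
    · have h : ContMDiffAt 𝓘(ℝ, ℂ) 𝓘(ℝ, ℂ) ∞ (Inv.inv : ℂ → ℂ) (g y) :=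
        (contDiffAt_inv ℝ hy.2).contMDiffAt
      exact h.comp_contMDiffWithinAt y ((hg.1 y hy.1).mono Set.inter_subset_left)
    · refine (hg.2 y hy.1 b hb).inv ?_
      rw [slice_eq_slicePoint, slicePoint_self hb]
      exact hy.2
  refine IsUnit.of_mul_eq_one ⟨((fun y => (g y)⁻¹ : M → ℂ) : Germ (𝓝 x) ℂ), _, _, hV, ⟨hx, hgx⟩,
    hinv, rfl⟩ (Subtype.ext (Germ.coe_eq.2 ?_))
  filter_upwards [hV.mem_nhds ⟨hx, hgx⟩] with y hy
  exact mul_inv_cancel₀ hy.2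

/-- The restriction of germs of functions to the fibre. -/
def restrictStalk (𝒟 : ManifoldDeformation n s ι M P) (x : M) :
    𝒟.stalk x →+* 𝒟.fiberStalk x where
  toFun f := ⟨𝒟.restrictGerm f.1, by
    obtain ⟨_, U, f, hU, hx, hf, rfl⟩ := f
    exact ⟨U, f, hU, hx, fun y hy => hf.2 y hy.1, rfl⟩⟩
  map_zero' := rfl
  map_one' := rfl
  map_add' := by
    rintro ⟨_, U, X, hU, hx, hX, rfl⟩ ⟨_, V, Y, hV, hx', hY, rfl⟩
    rfl
  map_mul' := by
    rintro ⟨_, U, X, hU, hx, hX, rfl⟩ ⟨_, V, Y, hV, hx', hY, rfl⟩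
    rfl

theorem restrictField_smul_stalk (f : 𝒟.stalk x) (X : 𝒟.fieldStalk x) :
    𝒟.restrictField x (f • X) = 𝒟.restrictStalk x f • 𝒟.restrictField x X := by
  obtain ⟨_, U, f, hU, hx, hf, rfl⟩ := f
  obtain ⟨_, U, X, hU, hx', hX, rfl⟩ := X
  rfl

/-- The matrix of the components of the vector fields `e j` with respect to the frame
`∂/∂zᵃ_i`. -/
def componentMatrix {q : ℕ} (a : ι) (e : Fin q → M → ι → Fin n → ℂ) :
    Matrix (Fin n) (Fin q) (M → ℂ) :=
  Matrix.of fun i j y => e j y a i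

namespace Foliation

variable (F : 𝒟.Foliation)

/-- The rank of the foliation at `x`: the dimension of the space of the values at `x` of its
sections. -/
def rankAt (x : M) : ℕ :=
  Module.finrank ℂ (Submodule.span ℂ
    (Set.range fun g : F.stalk x => ((g : 𝒟.fieldStalk x) : Germ (𝓝 x) (ι → Fin n → ℂ)).value))

variable {F}

theorem mem_fieldStalk_of_map_eq {q : ℕ} {e : Fin q → M → ι → Fin n → ℂ}
    (h : (F.stalk x).map (𝒟.fieldStalk x).subtype =
      Submodule.span (𝒟.stalk x) (Set.range fun j => (e j : Germ (𝓝 x) (ι → Fin n → ℂ))))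
    (j : Fin q) : ∃ g ∈ F.stalk x, (g : Germ (𝓝 x) (ι → Fin n → ℂ)) = ↑(e j) := by
  have : (e j : Germ (𝓝 x) (ι → Fin n → ℂ)) ∈ (F.stalk x).map (𝒟.fieldStalk x).subtype := by
    rw [h]
    exact Submodule.subset_span ⟨j, rfl⟩
  obtain ⟨g, hg, hge⟩ := this
  exact ⟨g, hg, hge⟩

theorem value_mem_vertTangent (g : 𝒟.fieldStalk x) :
    (g : Germ (𝓝 x) (ι → Fin n → ℂ)).value ∈ 𝒟.vertTangent x := by
  obtain ⟨_, U, X, hU, hx, hX, rfl⟩ := g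
  exact hX.1 x hx

/-- Evaluation at `x` turns coefficients in the stalk into complex numbers. -/
theorem span_values_eq {q : ℕ} {e : Fin q → M → ι → Fin n → ℂ}
    (h : (F.stalk x).map (𝒟.fieldStalk x).subtype =
      Submodule.span (𝒟.stalk x) (Set.range fun j => (e j : Germ (𝓝 x) (ι → Fin n → ℂ)))) :
    Submodule.span ℂ (Set.range fun g : F.stalk x =>
      ((g : 𝒟.fieldStalk x) : Germ (𝓝 x) (ι → Fin n → ℂ)).value) =
    Submodule.span ℂ (Set.range fun j => e j x) := by
  apply le_antisymm
  · rw [Submodule.span_le]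
    rintro _ ⟨⟨g, hg⟩, rfl⟩
    have hg' : (g : Germ (𝓝 x) (ι → Fin n → ℂ)) ∈ Submodule.span (𝒟.stalk x)
        (Set.range fun j => (e j : Germ (𝓝 x) (ι → Fin n → ℂ))) := by
      rw [← h]
      exact ⟨g, hg, rfl⟩
    change (g : Germ (𝓝 x) (ι → Fin n → ℂ)).value ∈ Submodule.span ℂ (Set.range fun j => e j x)
    generalize (g : Germ (𝓝 x) (ι → Fin n → ℂ)) = γ at hg'
    induction hg' using Submodule.span_induction with
    | mem v hv =>
      obtain ⟨j, rfl⟩ := hv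
      exact Submodule.subset_span ⟨j, rfl⟩
    | zero => exact Submodule.zero_mem _
    | add v w _ _ hv hw =>
      have : (v + w).value = v.value + w.value :=
        map_add (Germ.valueₗ (𝕜 := ℂ) (E := ι → Fin n → ℂ) (x := x)) v w
      rw [this]
      exact Submodule.add_mem _ hv hw
    | smul c v _ hv =>
      rw [Subring.smul_def, Germ.value_smul]
      exact Submodule.smul_mem _ _ hv
  · rw [Submodule.span_le]
    rintro _ ⟨j, rfl⟩
    obtain ⟨g, hg, hge⟩ := mem_fieldStalk_of_map_eq h j
    refine Submodule.subset_span ⟨⟨g, hg⟩, ?_⟩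
    change (g : Germ (𝓝 x) (ι → Fin n → ℂ)).value = e j x
    rw [hge]
    rfl

/-- All values of sections lie in the tangent space of the fibre, on which taking components in the
chart `a` is injective; no dimension is lost. -/
theorem rankAt_eq_rank {q : ℕ} {e : Fin q → M → ι → Fin n → ℂ} (ha : x ∈ (𝒟.chart a).source)
    (h : (F.stalk x).map (𝒟.fieldStalk x).subtype =
      Submodule.span (𝒟.stalk x) (Set.range fun j => (e j : Germ (𝓝 x) (ι → Fin n → ℂ)))) :
    F.rankAt x = ((componentMatrix a e).map (Pi.evalRingHom _ x)).rank := by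
  have hle : Submodule.span ℂ (Set.range fun j => e j x) ≤ 𝒟.vertTangent x := by
    rw [← span_values_eq h, Submodule.span_le]
    rintro _ ⟨g, rfl⟩
    exact value_mem_vertTangent _
  rw [rankAt, span_values_eq h, Matrix.rank_eq_finrank_span_cols]
  have hmap : (Submodule.span ℂ (Set.range fun j => e j x)).map
      (LinearMap.proj a : (ι → Fin n → ℂ) →ₗ[ℂ] Fin n → ℂ) =
      Submodule.span ℂ (Set.range ((componentMatrix a e).map (Pi.evalRingHom _ x)).col) := by
    rw [Submodule.map_span, ← Set.range_comp]
    rfl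
  rw [← hmap, ← LinearMap.range_domRestrict]
  refine (LinearMap.finrank_range_of_inj ?_).symm
  rintro ⟨v, hv⟩ ⟨w, hw⟩ hvw
  exact Subtype.ext (vertTangent_ext ha (hle hv) (hle hw) hvw)

theorem stalk_eq_span {q : ℕ} {e : Fin q → M → ι → Fin n → ℂ}
    (h : (F.stalk x).map (𝒟.fieldStalk x).subtype =
      Submodule.span (𝒟.stalk x) (Set.range fun j => (e j : Germ (𝓝 x) (ι → Fin n → ℂ)))) :
    ∃ E : Fin q → 𝒟.fieldStalk x, (∀ j, (E j : Germ (𝓝 x) (ι → Fin n → ℂ)) = ↑(e j)) ∧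
      F.stalk x = Submodule.span (𝒟.stalk x) (Set.range E) := by
  choose E hE hEe using fun j => mem_fieldStalk_of_map_eq h j
  refine ⟨E, hEe, Submodule.map_injective_of_injective (𝒟.fieldStalk x).subtype_injective ?_⟩
  rw [h, Submodule.map_span, ← Set.range_comp]
  congr 2
  funext j
  exact (hEe j).symm

/-- The image of `X ⊗ [r]` is a constant multiple of the restriction of `X`, and restriction is
semilinear over the restriction of functions, so restricted generators generate. -/
theorem fiberStalk_eq_span {q : ℕ} {E : Fin q → 𝒟.fieldStalk x}
    (h : F.stalk x = Submodule.span (𝒟.stalk x) (Set.range E)) :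
    F.fiberStalk x =
      Submodule.span (𝒟.fiberStalk x) (Set.range fun j => 𝒟.restrictField x (E j)) := by
  apply le_antisymm
  · rw [fiberStalk, Submodule.span_le]
    rintro _ ⟨τ, rfl⟩
    induction τ using TensorProduct.induction_on with
    | zero =>
      rw [map_zero]
      exact Submodule.zero_mem _
    | add τ τ' hτ hτ' =>
      rw [map_add]
      exact Submodule.add_mem _ hτ hτ'
    | tmul X r =>
      refine Submodule.smul_mem _ _ ?_
      obtain ⟨X, hX⟩ := X
      change 𝒟.restrictField x X ∈ _
      rw [h] at hX
      induction hX using Submodule.span_induction with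
      | mem v hv =>
        obtain ⟨j, rfl⟩ := hv
        exact Submodule.subset_span ⟨j, rfl⟩
      | zero =>
        rw [map_zero]
        exact Submodule.zero_mem _
      | add v w _ _ hv hw =>
        rw [map_add]
        exact Submodule.add_mem _ hv hw
      | smul c v _ hv =>
        rw [restrictField_smul_stalk]
        exact Submodule.smul_mem _ _ hv
  · rw [Submodule.span_le]
    rintro _ ⟨j, rfl⟩
    have hj : E j ∈ F.stalk x := h ▸ Submodule.subset_span ⟨j, rfl⟩
    refine Submodule.subset_span ⟨(⟨E j, hj⟩ : F.stalk x) ⊗ₜ 1, ?_⟩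
    change 𝒟.fiberConst x (𝒟.quotEval x 1) • 𝒟.restrictField x (E j) = _
    rw [map_one, map_one, one_smul]

/-- Local generators of the foliation near `x`. -/
theorem exists_generators (F : 𝒟.Foliation) (x : M) :
    ∃ (U : Set M) (q : ℕ) (e : Fin q → M → ι → Fin n → ℂ), IsOpen U ∧ x ∈ U ∧
      ∀ y ∈ U, (F.stalk y).map (𝒟.fieldStalk y).subtype =
        Submodule.span (𝒟.stalk y) (Set.range fun j => (e j : Germ (𝓝 y) (ι → Fin n → ℂ))) := by
  obtain ⟨U, p, q, A, e, hU, hx, -, h⟩ := F.coherent x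
  exact ⟨U, q, e, hU, hx, fun y hy => (h y hy).1⟩

theorem eventually_rankAt_eq {q : ℕ} {e : Fin q → M → ι → Fin n → ℂ} {U : Set M}
    (ha : x ∈ (𝒟.chart a).source) (hU : IsOpen U) (hx : x ∈ U)
    (he : ∀ y ∈ U, (F.stalk y).map (𝒟.fieldStalk y).subtype =
        Submodule.span (𝒟.stalk y) (Set.range fun j => (e j : Germ (𝓝 y) (ι → Fin n → ℂ)))) :
    ∀ᶠ y in 𝓝 x, F.rankAt y = ((componentMatrix a e).map (Pi.evalRingHom _ y)).rank := by
  filter_upwards [hU.mem_nhds hx, (𝒟.chart a).open_source.mem_nhds ha] with y hyU hya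
  exact rankAt_eq_rank hya (he y hyU)

section Freeness

variable [IsManifold 𝓘(ℝ, DefModel n s) ∞ M]

/-- The freeness of the normal sheaves at `x` in terms of the matrix of the components of
generators of the foliation. -/
theorem exists_matrix_free_iff {q : ℕ} {e : Fin q → M → ι → Fin n → ℂ}
    (ha : x ∈ (𝒟.chart a).source)
    (h : (F.stalk x).map (𝒟.fieldStalk x).subtype =
      Submodule.span (𝒟.stalk x) (Set.range fun j => (e j : Germ (𝓝 x) (ι → Fin n → ℂ)))) :
    ∃ B : Matrix (Fin n) (Fin q) (𝒟.stalk x),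
      B.map (𝒟.stalk x).subtype = (componentMatrix a e).map (Germ.coeRingHom (𝓝 x)) ∧
      (Module.Free (𝒟.stalk x) (𝒟.fieldStalk x ⧸ F.stalk x) ↔ B.HasFreeComplement) ∧
      (Module.Free (𝒟.fiberStalk x) (𝒟.fiberFieldStalk x ⧸ F.fiberStalk x) ↔
        (B.map (𝒟.restrictStalk x)).HasFreeComplement) := by
  obtain ⟨E, hEe, hE⟩ := stalk_eq_span h
  refine ⟨Matrix.of fun i j => 𝒟.fieldComponents ha (E j) i, ?_, ?_, ?_⟩
  · ext i j
    change Germ.map (fun v : ι → Fin n → ℂ => v a i) (E j : Germ (𝓝 x) (ι → Fin n → ℂ)) = _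
    rw [hEe]
    rfl
  · rw [hE]
    exact Module.free_quotient_iff_hasFreeComplement _ (fieldComponents_bijective ha) E
  · rw [fiberStalk_eq_span hE, Module.free_quotient_iff_hasFreeComplement _
      (fiberFieldComponents_bijective ha)]
    have : (Matrix.of fun i j => 𝒟.fiberFieldComponents ha (𝒟.restrictField x (E j)) i) =
        (Matrix.of fun i j => 𝒟.fieldComponents ha (E j) i).map (𝒟.restrictStalk x) := by
      ext i j
      obtain ⟨U, X, hU, hx, hX, hEX⟩ := (E j).2
      change Germ.map (fun v : ι → Fin n → ℂ => v a i) (𝒟.restrictGerm (E j).1) =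
        𝒟.restrictGerm (Germ.map (fun v : ι → Fin n → ℂ => v a i) (E j).1)
      rw [hEX]
      rfl
    rw [this]

/-- The matrix on the fibre is the restriction of the matrix on the total space, and the identities
defining a free complement restrict with it. -/
theorem free_fiber_of_free (h : Module.Free (𝒟.stalk x) (𝒟.fieldStalk x ⧸ F.stalk x)) :
    Module.Free (𝒟.fiberStalk x) (𝒟.fiberFieldStalk x ⧸ F.fiberStalk x) := by
  obtain ⟨a, ha⟩ := 𝒟.cover x
  obtain ⟨U, q, e, hU, hx, he⟩ := F.exists_generators x
  obtain ⟨B, -, h1, h2⟩ := exists_matrix_free_iff ha (he x hx)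
  exact h2.2 ((h1.1 h).map _)

/-- Both directions are the rank criteria for matrices of germs; the converse uses that the stalk
contains the constants and inverts germs with nonzero value. -/
theorem free_iff_isLocalMax :
    Module.Free (𝒟.stalk x) (𝒟.fieldStalk x ⧸ F.stalk x) ↔ IsLocalMax F.rankAt x := by
  obtain ⟨a, ha⟩ := 𝒟.cover x
  obtain ⟨U, q, e, hU, hx, he⟩ := F.exists_generators x
  obtain ⟨B, hB, h1, -⟩ := exists_matrix_free_iff ha (he x hx)
  have hev := eventually_rankAt_eq ha hU hx he
  rw [h1]
  constructor
  · intro h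
    have h' := h.map (𝒟.stalk x).subtype
    rw [hB] at h'
    filter_upwards [hev, h'.rank_le (pure_le_nhds x)] with y hy hle
    rwa [hy, hev.self_of_nhds]
  · intro h
    refine Matrix.hasFreeComplement_of_rank_le (x := x)
      (fun c => show ((fun _ => c : M → ℂ) : Germ (𝓝 x) ℂ) ∈ 𝒟.stalk x from ⟨Set.univ, _, isOpen_univ, trivial, 𝒟.isRelHol_const _ c, rfl⟩)
      (fun σ f hσ hf => isUnit_stalk σ f hσ hf) hB ?_
    filter_upwards [hev, h] with y hy hle
    rwa [hy, hev.self_of_nhds] at hle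

/-- The same rank estimate, now for germs along the fibre, bounds the rank only at nearby points of
the fibre. -/
theorem isLocalMaxOn_of_free_fiber
    (h : Module.Free (𝒟.fiberStalk x) (𝒟.fiberFieldStalk x ⧸ F.fiberStalk x)) :
    IsLocalMaxOn F.rankAt (𝒟.fiber (𝒟.proj x)) x := by
  obtain ⟨a, ha⟩ := 𝒟.cover x
  obtain ⟨U, q, e, hU, hx, he⟩ := F.exists_generators x
  obtain ⟨B, hB, -, h1⟩ := exists_matrix_free_iff ha (he x hx)
  have hev := eventually_rankAt_eq ha hU hx he
  have h' := (h1.1 h).map (𝒟.fiberStalk x).subtype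
  have hB' : (B.map (𝒟.restrictStalk x)).map (𝒟.fiberStalk x).subtype =
      (componentMatrix a e).map (Germ.coeRingHom (𝓝[𝒟.fiber (𝒟.proj x)] x)) := by
    ext i j
    have hij : (B i j : Germ (𝓝 x) ℂ) = ↑(componentMatrix a e i j) :=
      congrFun (congrFun hB i) j
    change 𝒟.restrictGerm (B i j : Germ (𝓝 x) ℂ) = _
    rw [hij]
    rfl
  rw [hB'] at h'
  have hmem : x ∈ 𝒟.fiber (𝒟.proj x) := rfl
  have hle := h'.rank_le (pure_le_nhdsWithin hmem)
  filter_upwards [hev.filter_mono nhdsWithin_le_nhds, hle] with y hy hle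
  rwa [hy, hev.self_of_nhds]

end Freeness

end Foliation

end ManifoldDeformation

/-! ### Propagation of rank bounds by the identity theorem -/

/-- `R` picks combinations of columns forming `k` independent vectors and `L` is a left inverse. The
determinant of `L * B * R` plays the part of a nonvanishing `k × k` minor. -/
theorem Matrix.exists_mul_mul_eq_one_of_le_rank {K : Type*} [Field K] {n q k : ℕ}
    (B : Matrix (Fin n) (Fin q) K) (hk : k ≤ B.rank) :
    ∃ (L : Matrix (Fin k) (Fin n) K) (R : Matrix (Fin q) (Fin k) K), L * B * R = 1 := by
  let b := Module.finBasis K (LinearMap.range B.mulVecLin)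
  choose w hw using fun i : Fin k => (b (Fin.castLE hk i)).2
  let R : Matrix (Fin q) (Fin k) K := Matrix.of fun j i => w i j
  have hR : ∀ i, (B * R).col i = b (Fin.castLE hk i) := fun i => (hw i)
  have hinj : Function.Injective (B * R).mulVecLin := by
    rw [Matrix.coe_mulVecLin, Matrix.mulVec_injective_iff]
    have hli := (b.linearIndependent.comp _ (Fin.castLE_injective hk)).map'
      (LinearMap.range B.mulVecLin).subtype (Submodule.ker_subtype _)
    have hcol : (B * R).col = (LinearMap.range B.mulVecLin).subtype ∘ b ∘ Fin.castLE hk :=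
      funext hR
    rw [hcol]
    exact hli
  obtain ⟨g, hg⟩ := LinearMap.exists_leftInverse_of_injective _ (LinearMap.ker_eq_bot.2 hinj)
  refine ⟨LinearMap.toMatrix' g, R, ?_⟩
  apply Matrix.toLin'.injective
  rw [Matrix.mul_assoc, Matrix.toLin'_mul, Matrix.toLin'_toMatrix', Matrix.toLin'_one]
  exact hg

theorem Matrix.det_mul_mul_eq_zero_of_rank_lt {K : Type*} [Field K] {n q k : ℕ}
    (B : Matrix (Fin n) (Fin q) K) (L : Matrix (Fin k) (Fin n) K) (R : Matrix (Fin q) (Fin k) K)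
    (hk : B.rank < k) : (L * B * R).det = 0 := by
  by_contra h
  have h1 := rank_of_det_ne_zero h
  have h2 := (rank_mul_le_left (L * B) R).trans (rank_mul_le_right L B)
  rw [h1, Fintype.card_fin] at h2
  omega

/-- The identity theorem on a convex open set in several variables. -/
theorem eq_zero_of_eventually_eq_zero_of_convex {E : Type*} [NormedAddCommGroup E]
    [NormedSpace ℂ E] {f : E → ℂ} {D : Set E} (hD : IsOpen D) (hconv : Convex ℝ D)
    (hf : DifferentiableOn ℂ f D) {z w : E} (hz : z ∈ D) (hw : w ∈ D)
    (h : ∀ᶠ u in 𝓝 z, f u = 0) : f w = 0 := by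
  -- The complex line through `z` and `w` reduces the claim to one variable; convexity of `D` keeps
  -- the preimage connected.
  let ℓ : ℂ → E := fun c => z + c • (w - z)
  have hℓd : Differentiable ℂ ℓ := by fun_prop
  have hℓ0 : ℓ 0 = z := by simp [ℓ]
  have hℓ1 : ℓ 1 = w := by simp [ℓ]
  have hΛ : IsOpen (ℓ ⁻¹' D) := hD.preimage hℓd.continuous
  have hΛc : Convex ℝ (ℓ ⁻¹' D) := by
    intro u hu v hv α β hα hβ hαβ
    have : ℓ (α • u + β • v) = α • ℓ u + β • ℓ v := by
      simp only [ℓ, smul_add, add_smul, smul_assoc]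
      have : z = α • z + β • z := by rw [← add_smul, hαβ, one_smul]
      nth_rewrite 1 [this]
      abel
    rw [Set.mem_preimage, this]
    exact hconv hu hv hα hβ hαβ
  have han : AnalyticOnNhd ℂ (f ∘ ℓ) (ℓ ⁻¹' D) :=
    (hf.comp hℓd.differentiableOn fun _ hc => hc).analyticOnNhd hΛ
  have h0 : (0 : ℂ) ∈ ℓ ⁻¹' D := by rwa [Set.mem_preimage, hℓ0]
  have h1 : (1 : ℂ) ∈ ℓ ⁻¹' D := by rwa [Set.mem_preimage, hℓ1]
  have hev : (f ∘ ℓ) =ᶠ[𝓝 0] 0 := by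
    have ht : Tendsto ℓ (𝓝 0) (𝓝 z) := by
      have := hℓd.continuous.tendsto 0
      rwa [hℓ0] at this
    exact ht.eventually h
  have := han.eqOn_zero_of_preconnected_of_eventuallyEq_zero hΛc.isPreconnected h0 hev h1
  rwa [Function.comp_apply, hℓ1] at this

namespace ManifoldDeformation

variable {n s : ℕ} {ι M P : Type*}
  [TopologicalSpace M] [ChartedSpace (DefModel n s) M]
  [TopologicalSpace P] [ChartedSpace (Fin s → ℝ) P]
  {𝒟 : ManifoldDeformation n s ι M P} {a : ι} {x y : M}

theorem mem_fiber_iff {t : P} : x ∈ 𝒟.fiber t ↔ 𝒟.proj x = t := Iff.rfl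

theorem differentiableAt_slice_component {X : M → ι → Fin n → ℂ} {g : 𝒟.fieldStalk x}
    (hg : (g : Germ (𝓝 x) (ι → Fin n → ℂ)) = ↑X) (ha : x ∈ (𝒟.chart a).source) (i : Fin n) :
    DifferentiableAt ℂ (𝒟.slice a x fun y => X y a i) (𝒟.chart a x).1 := by
  obtain ⟨_, U, Y, hU, hx, hY, rfl⟩ := g
  refine ((hY.2 a i).2 x ⟨hx, ha⟩ a ha).congr_of_eventuallyEq ?_
  filter_upwards [(tendsto_slicePoint ha).eventually (Germ.coe_eq.1 hg)] with z hz
  rw [slice_eq_slicePoint, slice_eq_slicePoint, hz]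

namespace Foliation

variable {F : 𝒟.Foliation}

/-- Around each point there is a neighbourhood in which an upper bound for the rank propagates
along the fibres and in which the fibres vary continuously. -/
theorem exists_nhds_rankAt_le (F : 𝒟.Foliation) (x : M) :
    ∃ N : Set M, IsOpen N ∧ x ∈ N ∧
      (∀ y ∈ N, ∀ y' ∈ N, 𝒟.proj y' = 𝒟.proj y → ∀ k,
        (∀ᶠ w in 𝓝[𝒟.fiber (𝒟.proj y)] y, F.rankAt w ≤ k) → F.rankAt y' ≤ k) ∧
      ∀ y ∈ N, ∀ y' ∈ N, 𝒟.proj y' = 𝒟.proj y → ∀ O ∈ 𝓝 y,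
        ∀ᶠ w' in 𝓝 y', ∃ w ∈ O ∩ N, 𝒟.proj w = 𝒟.proj w' := by
  obtain ⟨a, ha⟩ := 𝒟.cover x
  obtain ⟨U, q, e, hU, hx, he⟩ := F.exists_generators x
  have hO : IsOpen ((𝒟.chart a).target ∩ (𝒟.chart a).symm ⁻¹' U) :=
    (𝒟.chart a).isOpen_inter_preimage_symm hU
  have hxO : 𝒟.chart a x ∈ (𝒟.chart a).target ∩ (𝒟.chart a).symm ⁻¹' U :=
    ⟨(𝒟.chart a).map_source ha, by rwa [Set.mem_preimage, (𝒟.chart a).left_inv ha]⟩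
  -- A ball for the sup norm is a product of balls, so every fibre that meets `N` does so in a copy
  -- of the same convex set `D`.
  obtain ⟨ε, hε, hball⟩ := Metric.isOpen_iff.1 hO _ hxO
  set D := Metric.ball (𝒟.chart a x).1 ε with hDdef
  set V := Metric.ball (𝒟.chart a x).2 ε with hVdef
  have hDV : ∀ z ∈ D, ∀ τ ∈ V,
      (z, τ) ∈ (𝒟.chart a).target ∧ (𝒟.chart a).symm (z, τ) ∈ U := by
    intro z hz τ hτ
    refine hball ?_
    rw [← ball_prod_same] at *
    exact ⟨hz, hτ⟩
  let N : Set M := (𝒟.chart a).source ∩ 𝒟.chart a ⁻¹' (D ×ˢ V)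
  have hN : IsOpen N := (𝒟.chart a).isOpen_inter_preimage (Metric.isOpen_ball.prod Metric.isOpen_ball)
  have hxN : x ∈ N := ⟨ha, Metric.mem_ball_self hε, Metric.mem_ball_self hε⟩
  have hNU : ∀ w ∈ N, w ∈ U := fun w hw => by
    have := (hDV _ hw.2.1 _ hw.2.2).2
    rwa [Prod.mk.eta, (𝒟.chart a).left_inv hw.1] at this
  have htarget : ∀ y ∈ N, ∀ z ∈ D, (z, (𝒟.chart a y).2) ∈ (𝒟.chart a).target := fun y hy z hz =>
    (hDV z hz _ hy.2.2).1
  have hslice : ∀ y ∈ N, ∀ z ∈ D, 𝒟.slicePoint a y z ∈ N := fun y hy z hz => by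
    refine ⟨slicePoint_mem_source (htarget y hy z hz), ?_⟩
    rw [Set.mem_preimage, chart_slicePoint (htarget y hy z hz)]
    exact ⟨hz, hy.2.2⟩
  refine ⟨N, hN, hxN, fun y hy y' hy' hproj k hev => ?_, fun y hy y' hy' hproj O hO => ?_⟩
  · by_contra! hlt
    rw [rankAt_eq_rank hy'.1 (he y' (hNU y' hy'))] at hlt
    -- `L` and `R` are constant matrices adapted to the point `y'`, of size `k + 1` since the rank
    -- there is assumed to exceed `k`. The resulting function `f` is `1` at `y'`, yet vanishes on
    -- the fibre near `y`, where the rank is at most `k`.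
    obtain ⟨L, R, hLR⟩ := Matrix.exists_mul_mul_eq_one_of_le_rank _ (Nat.succ_le_of_lt hlt)
    let f : M → ℂ := fun w => (L * (componentMatrix a e).map (Pi.evalRingHom _ w) * R).det
    have hf : DifferentiableOn ℂ (𝒟.slice a y f) D := by
      intro z hz
      refine DifferentiableAt.differentiableWithinAt ?_
      have hcomp : ∀ i j, DifferentiableAt ℂ (𝒟.slice a y fun w => e j w a i) z := by
        intro i j
        have hw := hslice y hy z hz
        obtain ⟨g, -, hg⟩ := mem_fieldStalk_of_map_eq (he _ (hNU _ hw)) j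
        have := differentiableAt_slice_component hg hw.1 i
        rwa [slice_congr hw.1 hy.1 (proj_slicePoint hy.1 (htarget y hy z hz)),
          chart_slicePoint (htarget y hy z hz)] at this
      -- The Leibniz formula exhibits `f` as a polynomial in the holomorphic components.
      have heq : 𝒟.slice a y f = fun z => ∑ σ : Equiv.Perm (Fin (k + 1)),
          Equiv.Perm.sign σ • ∏ l, ∑ j, (∑ i, L (σ l) i * 𝒟.slice a y (fun w => e j w a i) z) *
            R j l := by
        funext z
        change (_ : Matrix _ _ ℂ).det = _
        rw [Matrix.det_apply]
        rfl
      rw [heq]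
      refine DifferentiableAt.fun_sum fun σ _ => DifferentiableAt.fun_const_smul ?_ _
      refine (HasFDerivAt.finsetProd fun l _ =>
        DifferentiableAt.hasFDerivAt ?_).differentiableAt
      refine DifferentiableAt.fun_sum fun j _ => DifferentiableAt.mul_const ?_ _
      exact DifferentiableAt.fun_sum fun i _ => (hcomp i j).const_mul _
    have hzero : ∀ᶠ z in 𝓝 (𝒟.chart a y).1, 𝒟.slice a y f z = 0 := by
      have hDy : ∀ᶠ z in 𝓝 (𝒟.chart a y).1, z ∈ D := Metric.isOpen_ball.mem_nhds hy.2.1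
      have ht : Tendsto (𝒟.slicePoint a y) (𝓝 (𝒟.chart a y).1) (𝓝[𝒟.fiber (𝒟.proj y)] y) := by
        refine tendsto_nhdsWithin_iff.2 ⟨tendsto_slicePoint hy.1, ?_⟩
        filter_upwards [hDy] with z hz
        exact proj_slicePoint hy.1 (htarget y hy z hz)
      filter_upwards [hDy, ht.eventually hev] with z hz hr
      have hw := hslice y hy z hz
      rw [rankAt_eq_rank hw.1 (he _ (hNU _ hw))] at hr
      exact Matrix.det_mul_mul_eq_zero_of_rank_lt _ L R (Nat.lt_succ_of_le hr)
    have h0 := eq_zero_of_eventually_eq_zero_of_convex Metric.isOpen_ball (convex_ball _ _) hf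
      hy.2.1 hy'.2.1 hzero
    rw [slice_eq_slicePoint, slicePoint_fst_chart hy.1 hy'.1 hproj] at h0
    change (_ : Matrix _ _ ℂ).det = 0 at h0
    rw [hLR, Matrix.det_one] at h0
    exact one_ne_zero h0
  -- The point required on the fibre through `w'` is the one with the same `z` coordinate as `y`; it
  -- tends to `y` as `w'` tends to `y'`.
  · have hcont : Tendsto (fun w' => 𝒟.slicePoint a w' (𝒟.chart a y).1) (𝓝 y') (𝓝 y) := by
      have h1 : Tendsto (fun w' => ((𝒟.chart a y).1, (𝒟.chart a w').2)) (𝓝 y')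
          (𝓝 (𝒟.chart a y)) := by
        have h2 := ((𝒟.chart a).continuousAt hy'.1).snd
        have h3 : 𝒟.chart a y = ((𝒟.chart a y).1, (𝒟.chart a y').2) := by
          rw [(snd_chart_eq_iff hy'.1 hy.1).2 hproj]
        rw [h3]
        exact tendsto_const_nhds.prodMk_nhds h2
      exact ((𝒟.chart a).tendsto_symm hy.1).comp h1
    filter_upwards [hcont.eventually (inter_mem hO (hN.mem_nhds hy)), hN.mem_nhds hy']
      with w' hw hw'
    exact ⟨_, hw, proj_slicePoint hw'.1 (htarget w' hw' _ hy.2.1)⟩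

/-- On a connected fibre, an upper bound for the rank of the foliation near one point of the fibre
holds on the whole fibre. -/
theorem rankAt_le_of_eventually_fiber {t : P} (ht : IsPreconnected (𝒟.fiber t)) {k : ℕ}
    (hx : x ∈ 𝒟.fiber t) (hy : y ∈ 𝒟.fiber t)
    (h : ∀ᶠ w in 𝓝[𝒟.fiber t] x, F.rankAt w ≤ k) : F.rankAt y ≤ k := by
  -- Transfer of the bound from `u` to `v` is a transitive relation, so on a preconnected fibre it
  -- need only be checked, in both directions, between nearby points.
  have key := ht.induction₂' (fun u v => (∀ᶠ w in 𝓝[𝒟.fiber t] u, F.rankAt w ≤ k) →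
    ∀ᶠ w in 𝓝[𝒟.fiber t] v, F.rankAt w ≤ k) ?_ (fun _ _ _ _ _ _ h1 h2 h3 => h2 (h1 h3)) hx hy h
  · exact key.self_of_nhdsWithin hy
  · intro x hx
    obtain ⟨N, hN, hxN, hN1, -⟩ := F.exists_nhds_rankAt_le x
    have htrans : ∀ u ∈ N, ∀ v ∈ N, u ∈ 𝒟.fiber t → v ∈ 𝒟.fiber t →
        (∀ᶠ w in 𝓝[𝒟.fiber t] u, F.rankAt w ≤ k) → ∀ᶠ w in 𝓝[𝒟.fiber t] v, F.rankAt w ≤ k := by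
      intro u hu v hv hut hvt h
      filter_upwards [mem_nhdsWithin_of_mem_nhds (hN.mem_nhds hv), self_mem_nhdsWithin]
        with w hw hwt
      rw [mem_fiber_iff] at hut hwt
      subst hut
      exact hN1 u hu w hw hwt k h
    filter_upwards [mem_nhdsWithin_of_mem_nhds (hN.mem_nhds hxN), self_mem_nhdsWithin] with y hy hyt
    exact ⟨htrans x hxN y hy hx hyt, htrans y hy x hxN hyt hx⟩

/-- On a connected fibre, an upper bound for the rank of the foliation in a neighbourhood of one
point of the fibre holds in a neighbourhood of each point of the fibre. -/
theorem eventually_rankAt_le_of_eventually {t : P} (ht : IsPreconnected (𝒟.fiber t)) {k : ℕ}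
    (hx : x ∈ 𝒟.fiber t) (hy : y ∈ 𝒟.fiber t)
    (h : ∀ᶠ w in 𝓝 x, F.rankAt w ≤ k) : ∀ᶠ w in 𝓝 y, F.rankAt w ≤ k := by
  refine ht.induction₂' (fun u v => (∀ᶠ w in 𝓝 u, F.rankAt w ≤ k) →
    ∀ᶠ w in 𝓝 v, F.rankAt w ≤ k) ?_ (fun _ _ _ _ _ _ h1 h2 h3 => h2 (h1 h3)) hx hy h
  intro x hx
  obtain ⟨N, hN, hxN, hN1, hN2⟩ := F.exists_nhds_rankAt_le x
  have htrans : ∀ u ∈ N, ∀ v ∈ N, u ∈ 𝒟.fiber t → v ∈ 𝒟.fiber t →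
      (∀ᶠ w in 𝓝 u, F.rankAt w ≤ k) → ∀ᶠ w in 𝓝 v, F.rankAt w ≤ k := by
    intro u hu v hv hut hvt h
    have hp : 𝒟.proj v = 𝒟.proj u := by
      rw [mem_fiber_iff] at hut hvt
      rw [hut, hvt]
    -- Each point `w` near `v` shares its fibre with some `w'` so close to `u` that the bound holds
    -- in a whole neighbourhood of `w'`; it then passes from `w'` to `w` along that fibre.
    filter_upwards [hN.mem_nhds hv, hN2 u hu v hv hp _ (eventually_eventually_nhds.2 h)]
      with w hw ⟨w', ⟨hw'O, hw'N⟩, hw'p⟩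
    exact hN1 w' hw'N w hw hw'p.symm k (Eventually.filter_mono nhdsWithin_le_nhds hw'O)
  filter_upwards [mem_nhdsWithin_of_mem_nhds (hN.mem_nhds hxN), self_mem_nhdsWithin] with y hy hyt
  exact ⟨htrans x hxN y hy hx hyt, htrans y hy x hxN hyt hx⟩

end Foliation

end ManifoldDeformation

end

/-! ### Comparison of the two singular sets -/

theorem proposition3p4 {n s : ℕ} {ι M P : Type*}
    [TopologicalSpace M] [ChartedSpace (DefModel n s) M]
    [IsManifold 𝓘(ℝ, DefModel n s) ∞ M]
    [TopologicalSpace P] [ChartedSpace (Fin s → ℝ) P]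
    [IsManifold 𝓘(ℝ, Fin s → ℝ) ∞ P]
    (𝒟 : ManifoldDeformation n s ι M P) (F : 𝒟.Foliation)
    (t : P) (ht : IsConnected (𝒟.fiber t)) :
    F.fiberSingularSet t = F.singularSet ∩ 𝒟.fiber t := by
  unfold ManifoldDeformation.Foliation.fiberSingularSet
  split_ifs with hsub
  · exact (Set.inter_eq_right.2 hsub).symm
  · obtain ⟨y, hyt, hy⟩ := Set.not_subset.1 hsub
    have hymax : IsLocalMax F.rankAt y :=
      ManifoldDeformation.Foliation.free_iff_isLocalMax.1 (not_not.1 hy)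
    ext x
    refine ⟨fun ⟨hxt, hx⟩ =>
      ⟨fun h => hx (ManifoldDeformation.Foliation.free_fiber_of_free h), hxt⟩,
      fun ⟨hx, hxt⟩ => ⟨hxt, fun h => hx ?_⟩⟩
    have hxmax := ManifoldDeformation.Foliation.isLocalMaxOn_of_free_fiber h
    rw [ManifoldDeformation.mem_fiber_iff.1 hxt] at hxmax
    rw [ManifoldDeformation.Foliation.free_iff_isLocalMax]
    -- The bound by the rank at `x` travels along the fibre to `y`, while the bound by the rank at
    -- `y` travels back to a full neighbourhood of `x`.
    have hyx := ManifoldDeformation.Foliation.rankAt_le_of_eventually_fiber ht.isPreconnected hxt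
      hyt hxmax
    have hx' := ManifoldDeformation.Foliation.eventually_rankAt_le_of_eventually ht.isPreconnected
      hyt hxt hymax
    exact hx'.mono fun w hw => hw.trans hyx
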